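/- **Proposition 9.6** (Goldston–Yıldırım correlation estimate). For a real number $R$ and an integer $n$ put $$\Lambda_R(n):=\sum_{d\mid n,\ 1\le d\le R}\mu(d)\log(R/d).$$ Let $k\ge 1$ be an integer and, for each positive integer $N$, let $R=R(N):=N^{k^{-1}2^{-k-4}}$. Let $w=w(N)$ be a real-valued function tending to infinity with $N$, and let $W=W(N):=\prod_{p\le w(N)}p$; here and below $p$ denotes primes. Assume that $w$ is sufficiently slowly growing, i.e. that $w(N)\le w_0(N)$ for all large $N$, where $w_0$ is a certain function tending to infinity that depends only on $k$. Let $m\ge 1$ be an integer. Then for all $N$ sufficiently large (depending on $m$, $k$ and $w$), all distinct integers $h_1,\dots,h_m$ with $|h_i|\le N^2$, and all bounded intervals $B\subset\mathbb R$ of length at least $R^{10m}$, $$\mathbb E\bigl(\Lambda_R(W(x+h_1)+1)^2\cdots\Lambda_R(W(x+h_m)+1)^2\,\big|\,x\in B\bigr)\ \le\ (1+o_m(1))\left(\frac{W\log R}{\phi(W)}\right)^m\prod_{p\mid\Delta}\bigl(1+O_m(p^{-1/2})\bigr),$$ where $\Delta:=\prod_{1\le i<j\le m}|h_i-h_j|$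 and $\mathbb E(\,\cdot\mid x\in B)$ is the average over the integers $x\in B$. Here $O_m(p^{-1/2})$ denotes a quantity of absolute value at most $C_m p^{-1/2}$, where $C_m$ depends only on $m$; and $o_m(1)$ tends to $0$ as $N\to\infty$ for fixed $m$, $k$ and $w$, uniformly in $h_1,\dots,h_m$ and $B$. -/

import Mathlib

open Filter Topology

noncomputable section

namespace GoldstonYildirim

/-- The truncated divisor sum `Λ_R(n) = ∑_{d ∣ n, d ≤ R} μ(d) log (R / d)`, over positive
integers `d`, for a real parameter `R` and an integer `n` (of either sign). -/
def truncLambda (R : ℝ) (n : ℤ) : ℝ :=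
  ∑ d ∈ (Finset.Icc 1 ⌊R⌋₊).filter (fun d : ℕ => (d : ℤ) ∣ n),
    (ArithmeticFunction.moebius d : ℝ) * Real.log (R / d)

/-- `R = N ^ (k⁻¹ 2 ^ (-k - 4))`. -/
def sieveLevel (k N : ℕ) : ℝ :=
  (N : ℝ) ^ (1 / ((k : ℝ) * 2 ^ (k + 4)))

/-- `W = ∏_{p ≤ w} p`, the product of all primes up to the real number `w`. -/
def primeProd (w : ℝ) : ℕ :=
  primorial ⌊w⌋₊

/-- `Δ = ∏_{i < j} |h i - h j|`. -/
def diffProd {m : ℕ} (h : Fin m → ℤ) : ℕ :=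
  ∏ q ∈ Finset.univ.filter (fun q : Fin m × Fin m => q.1 < q.2), (h q.1 - h q.2).natAbs

/-- The average `𝔼(f(x) | x ∈ B)` of `f` over the integer points of a bounded set `B ⊆ ℝ`. -/
def intAverage (B : Set ℝ) (f : ℤ → ℝ) : ℝ :=
  (∑ᶠ x ∈ {x : ℤ | (x : ℝ) ∈ B}, f x) / ({x : ℤ | (x : ℝ) ∈ B}.ncard : ℝ)

end GoldstonYildirim

end

/-! The sum over a full period, the product Q of the primes p ≤ R not dividing W, factors over
primes once dilations of the 2m-tuple of divisors are kept as formal symbols. By the Chinese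
remainder theorem its mean is the value at the tuple 1 of ∏_p T_p applied to f(a) = ∏_j log⁺(R /
a_j), where T_p lies in the monoid algebra of ℕ^{2m} acting on bounded functions by dilation. Let
x_j be dilation by p in coordinate j with weight 1/p, and y_i dilation by p in both coordinates of
the i-th pair with weight 1/p. If the h_i are distinct mod p, then T_p = 1 - ∑ x_j + ∑ y_i, and T_p
∏(1 - y_i) agrees with ∏(1 - x_j) up to O(p⁻²) in operator norm; for p ∣ Δ the error is O(p⁻¹).
These are the Euler factors of ∏ ζ(1+s_i+s_i') / (ζ(1+s_i) ζ(1+s_i')), but no multiple contour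
integral is needed. Dilations are contractions for the sup norm and each 1 - x_j is bounded below,
so ‖T_p ∏(1 - y_i) F‖ ≤ (1 + error) ‖∏(1 - x_j) F‖ for every F (`norm_act_avgElem_mul_le`). Since
everything commutes, these inequalities multiply over p (`norm_act_prod_le`,
`abs_act_prod_avgElem_le`). The model is explicit. On f, the inverse of ∏_p (1 - y_i) is ∑ n⁻¹ [n]
over n ≤ R coprime to W, while ∏_p (1 - x_j) turns log⁺ into M(x) = ∑ μ(d)/d log⁺(x/d) over d
coprime to W. What remains is a product of m sums `pairSum`. Here M(x) → W/φ(W), by a Tauberian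
theorem and the nonvanishing of L(s, χ₀) on Re s = 1 (`tendsto_moebiusLogSum`). As ∑ n⁻¹ is about
(φ(W)/W) log R, each pair sum is at most (1 + η)(W/φ(W)) log R (`eventually_abs_pairSum_le`).
Passing from a full period to B costs R^{6m}, negligible against the length R^{10m}. Primes not
dividing WΔ exceed w and lose only exp(O(1/w)) together. The analytic input holds eventually for
each fixed W, and w₀ comes from a diagonal argument. -/

open Filter Topology

/-! ### A Tauberian theorem for Laplace transforms -/

noncomputable section
namespace GoldstonYildirim

open MeasureTheory FourierTransform SchwartzMap

/-- A Schwartz function of compact support with value `1` at the origin. -/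
theorem exists_schwartz_bump : ∃ ψ : 𝓢(ℝ, ℂ), HasCompactSupport ψ ∧ ψ 0 = 1 := by
  let f : ContDiffBump (0 : ℝ) := default
  have h₁ : HasCompactSupport (fun x : ℝ => ((f x : ℝ) : ℂ)) :=
    f.hasCompactSupport.comp_left (g := fun r : ℝ => (r : ℂ)) (by simp)
  have h₂ : ContDiff ℝ (⊤ : ℕ∞) (fun x : ℝ => ((f x : ℝ) : ℂ)) :=
    Complex.ofRealCLM.contDiff.comp f.contDiff
  refine ⟨h₁.toSchwartzMap h₂, h₁, ?_⟩
  change ((f 0 : ℝ) : ℂ) = 1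
  have h : f 0 = 1 := f.one_of_mem_closedBall (by simpa using f.rIn_pos.le)
  rw [h, Complex.ofReal_one]

theorem integral_fourier_eq (ψ : 𝓢(ℝ, ℂ)) : ∫ x, (𝓕 ψ) x = ψ 0 := by
  have h : 𝓕⁻ (𝓕 ψ) = ψ := FourierTransform.fourierInv_fourier_eq ψ
  calc ∫ x, (𝓕 ψ) x = (𝓕⁻ (𝓕 ψ)) 0 := by rw [fourierInv_coe, Real.fourierInv_eq]; simp
    _ = ψ 0 := by rw [h]

theorem norm_le_mul_abs_of_lipschitz {F : ℝ → ℂ} {B : NNReal} (hF : LipschitzWith B F)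
    (h0 : F 0 = 0) (u : ℝ) : ‖F u‖ ≤ B * |u| := by
  simpa [h0] using hF.norm_sub_le u 0

theorem integrable_mul_exp_neg {F : ℝ → ℂ} {B : NNReal} (hF : LipschitzWith B F)
    (h0 : ∀ u ≤ 0, F u = 0) {z : ℂ} (hz : 0 < z.re) :
    Integrable (fun u : ℝ => F u * Complex.exp (-z * u)) := by
  have hexp : IntegrableOn (fun u : ℝ => (B : ℝ) * (2 / z.re) * Real.exp (-(z.re / 2) * u))
      (Set.Ioi 0) := (exp_neg_integrableOn_Ioi 0 (by positivity)).const_mul _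
  have hind := (integrable_indicator_iff measurableSet_Ioi).2 hexp
  refine hind.mono' (Continuous.aestronglyMeasurable ?_) (Eventually.of_forall fun u => ?_)
  · exact hF.continuous.mul (by fun_prop)
  rcases le_or_gt u 0 with hu | hu
  · simp [h0 u hu, Set.indicator, not_lt.2 hu]
  · rw [Set.indicator_of_mem (Set.mem_Ioi.2 hu), norm_mul, Complex.norm_exp]
    have h1 := norm_le_mul_abs_of_lipschitz hF (h0 0 le_rfl) u
    rw [abs_of_pos hu] at h1
    -- Half of the exponential decay is spent on the linear growth of F; the other half gives
    -- integrability.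
    have h2 : u ≤ 2 / z.re * Real.exp (z.re / 2 * u) := by
      have := Real.add_one_le_exp (z.re / 2 * u)
      have h3 : z.re / 2 * u ≤ Real.exp (z.re / 2 * u) := by linarith
      calc u = 2 / z.re * (z.re / 2 * u) := by field_simp
        _ ≤ _ := by gcongr
    have h4 : (-z * (u : ℂ)).re = -(z.re * u) := by simp
    rw [h4]
    calc ‖F u‖ * Real.exp (-(z.re * u))
        ≤ (B * (2 / z.re * Real.exp (z.re / 2 * u))) * Real.exp (-(z.re * u)) := by
          gcongr; exact h1.trans (by gcongr)
      _ = B * (2 / z.re) * (Real.exp (z.re / 2 * u) * Real.exp (-(z.re * u))) := by ring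
      _ = _ := by rw [← Real.exp_add]; congr 2; ring

theorem integrable_comp_affine (K : 𝓢(ℝ, ℂ)) {l : ℝ} (hl : 0 < l) (v : ℝ) :
    Integrable (fun u : ℝ => |u| * ‖K (l * (u - v))‖) := by
  have h0 : Integrable (fun x : ℝ => ‖K x‖) := K.integrable.norm
  have h1 : Integrable (fun x : ℝ => |x| * ‖K x‖) := by
    simpa using K.integrable_pow_mul volume 1
  have h2 : Integrable (fun x : ℝ => l⁻¹ * (|x| * ‖K x‖) + |v| * ‖K x‖) :=
    (h1.const_mul _).add (h0.const_mul _)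
  have h3 := (h2.comp_mul_left' hl.ne').comp_sub_right v
  refine h3.mono' (Continuous.aestronglyMeasurable ?_) (Eventually.of_forall fun u => ?_)
  · have := K.continuous
    fun_prop
  · simp only [norm_mul, Real.norm_eq_abs, abs_abs, abs_norm]
    rw [abs_mul, abs_of_pos hl, ← mul_assoc, ← mul_assoc, inv_mul_cancel₀ hl.ne', one_mul,
      ← add_mul]
    gcongr
    calc |u| = |(u - v) + v| := by ring_nf
      _ ≤ _ := abs_add_le _ _

/-- Fubini after writing out 𝓕 ψ, with σ > 0 supplying absolute convergence. The Fourier phase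
shifts the Laplace variable along the vertical line Re z = σ. -/
theorem integral_laplace_mul_fourier {F : ℝ → ℂ} {B : NNReal} (hF : LipschitzWith B F)
    (h0 : ∀ u ≤ 0, F u = 0) (ψ : 𝓢(ℝ, ℂ)) {σ : ℝ} (hσ : 0 < σ) (l v : ℝ) :
    ∫ u : ℝ, F u * Complex.exp (-σ * u) * (𝓕 ψ) (l * (u - v)) =
      ∫ t : ℝ, ψ t * Complex.exp (2 * Real.pi * l * t * v * Complex.I) *
        ∫ u : ℝ, F u * Complex.exp (-(σ + 2 * Real.pi * l * t * Complex.I) * u) := by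
  have hint : Integrable (fun q : ℝ × ℝ => F q.1 * Complex.exp (-σ * q.1) *
      (ψ q.2 * Complex.exp ((-2 * Real.pi * q.2 * (l * (q.1 - v)) : ℝ) * Complex.I))) := by
    have hA := integrable_mul_exp_neg hF h0 (z := (σ : ℂ)) (by simpa using hσ)
    have h := hA.mul_prod (ψ.integrable (μ := volume))
    refine h.mono (Continuous.aestronglyMeasurable ?_) (Eventually.of_forall fun q => ?_)
    · have h1 := hF.continuous
      fun_prop
    · simp only [norm_mul, Complex.norm_exp_ofReal_mul_I, mul_one]
      exact le_rfl
  calc ∫ u : ℝ, F u * Complex.exp (-σ * u) * (𝓕 ψ) (l * (u - v))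
      = ∫ u : ℝ, ∫ t : ℝ, F u * Complex.exp (-σ * u) *
          (ψ t * Complex.exp ((-2 * Real.pi * t * (l * (u - v)) : ℝ) * Complex.I)) := by
        congr 1 with u
        rw [integral_const_mul, fourier_coe, Real.fourier_eq']
        congr 2 with t
        simp only [smul_eq_mul, RCLike.inner_apply, conj_trivial]
        rw [mul_comm]
        congr 3
        push_cast; ring
    _ = ∫ t : ℝ, ∫ u : ℝ, F u * Complex.exp (-σ * u) *
          (ψ t * Complex.exp ((-2 * Real.pi * t * (l * (u - v)) : ℝ) * Complex.I)) :=
        integral_integral_swap hint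
    _ = _ := by
        congr 1 with t
        rw [← integral_const_mul]
        congr 1 with u
        have : Complex.exp (-σ * u) *
            Complex.exp ((-2 * Real.pi * t * (l * (u - v)) : ℝ) * Complex.I) =
            Complex.exp (2 * Real.pi * l * t * v * Complex.I) *
              Complex.exp (-(σ + 2 * Real.pi * l * t * Complex.I) * u) := by
          rw [← Complex.exp_add, ← Complex.exp_add]
          congr 1; push_cast; ring
        calc _ = F u * ψ t * (Complex.exp (-σ * u) *
            Complex.exp ((-2 * Real.pi * t * (l * (u - v)) : ℝ) * Complex.I)) := by ring
          _ = _ := by rw [this]; ring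

/-- Let σ → 0⁺ in the preceding identity. On the left, linear growth of F is dominated by Schwartz
decay; on the right, the compact support of ψ confines H to a compact subset of the closed
half-plane, where it is bounded. -/
theorem integral_mul_fourier_eq {F : ℝ → ℂ} {B : NNReal} (hF : LipschitzWith B F)
    (h0 : ∀ u ≤ 0, F u = 0) {H : ℂ → ℂ} (hH : ContinuousOn H {z | 0 ≤ z.re})
    (hL : ∀ z : ℂ, 0 < z.re → ∫ u : ℝ, F u * Complex.exp (-z * u) = H z)
    {ψ : 𝓢(ℝ, ℂ)} (hψ : HasCompactSupport ψ) {l : ℝ} (hl : 0 < l) (v : ℝ) :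
    ∫ u : ℝ, F u * (𝓕 ψ) (l * (u - v)) =
      ∫ t : ℝ, ψ t * Complex.exp (2 * Real.pi * l * t * v * Complex.I) *
        H (2 * Real.pi * l * t * Complex.I) := by
  have hleft : Tendsto (fun σ : ℝ => ∫ u : ℝ, F u * Complex.exp (-σ * u) *
      (𝓕 ψ) (l * (u - v))) (𝓝[>] 0) (𝓝 (∫ u : ℝ, F u * (𝓕 ψ) (l * (u - v)))) := by
    refine tendsto_integral_filter_of_dominated_convergence
      (fun u => B * (|u| * ‖(𝓕 ψ) (l * (u - v))‖)) ?_ ?_ ?_ ?_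
    · refine Eventually.of_forall fun σ => Continuous.aestronglyMeasurable ?_
      have h1 := hF.continuous
      have h2 := (𝓕 ψ).continuous
      fun_prop
    · filter_upwards [self_mem_nhdsWithin] with σ hσ
      refine Eventually.of_forall fun u => ?_
      rw [norm_mul, norm_mul, ← mul_assoc]
      refine mul_le_mul_of_nonneg_right ?_ (norm_nonneg _)
      rcases le_or_gt u 0 with hu | hu
      · simp only [h0 u hu, norm_zero, zero_mul]; positivity
      · refine le_trans (mul_le_of_le_one_right (norm_nonneg _) ?_)
          (norm_le_mul_abs_of_lipschitz hF (h0 0 le_rfl) u)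
        rw [Complex.norm_exp]
        simpa using mul_nonneg (le_of_lt hσ) hu.le
    · exact (integrable_comp_affine _ hl v).const_mul _
    · refine Eventually.of_forall fun u => ?_
      have : ContinuousAt (fun σ : ℝ => F u * Complex.exp (-σ * u) * (𝓕 ψ) (l * (u - v))) 0 := by
        fun_prop
      simpa using this.tendsto.mono_left nhdsWithin_le_nhds
  obtain ⟨T, hT⟩ : ∃ T : ℝ, ∀ t, ψ t ≠ 0 → |t| ≤ T := by
    obtain ⟨T, hT⟩ := hψ.isCompact.isBounded.exists_norm_le
    exact ⟨T, fun t ht => hT t (subset_tsupport _ ht)⟩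
  have hcompact : IsCompact ((fun q : ℝ × ℝ => (q.1 : ℂ) + 2 * Real.pi * l * q.2 * Complex.I) ''
      (Set.Icc 0 1 ×ˢ Set.Icc (-T) T)) :=
    (isCompact_Icc.prod isCompact_Icc).image (by fun_prop)
  obtain ⟨C, hC⟩ := hcompact.exists_bound_of_continuousOn (f := H) (hH.mono (by
    rintro _ ⟨q, hq, rfl⟩
    simpa using hq.1.1))
  have hright : Tendsto (fun σ : ℝ => ∫ t : ℝ, ψ t *
      Complex.exp (2 * Real.pi * l * t * v * Complex.I) *
        H (σ + 2 * Real.pi * l * t * Complex.I)) (𝓝[>] 0)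
      (𝓝 (∫ t : ℝ, ψ t * Complex.exp (2 * Real.pi * l * t * v * Complex.I) *
        H (2 * Real.pi * l * t * Complex.I))) := by
    refine tendsto_integral_filter_of_dominated_convergence (fun t => ‖ψ t‖ * C) ?_ ?_ ?_ ?_
    · filter_upwards [self_mem_nhdsWithin] with σ hσ
      refine Continuous.aestronglyMeasurable ?_
      have h2 := ψ.continuous
      have h3 : Continuous (fun t : ℝ => H (σ + 2 * Real.pi * l * t * Complex.I)) :=
        hH.comp_continuous (by fun_prop) (fun t => by simpa using le_of_lt hσ)
      exact (h2.mul (by fun_prop)).mul h3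
    · filter_upwards [Ioo_mem_nhdsGT (zero_lt_one' ℝ)] with σ hσ
      refine Eventually.of_forall fun t => ?_
      have he : ‖Complex.exp (2 * Real.pi * l * t * v * Complex.I)‖ = 1 := by
        rw [← Complex.norm_exp_ofReal_mul_I (2 * Real.pi * l * t * v)]; push_cast; rfl
      rw [norm_mul, norm_mul, he, mul_one]
      by_cases ht : ψ t = 0
      · simp [ht]
      · gcongr
        exact hC _ ⟨(σ, t), ⟨⟨hσ.1.le, hσ.2.le⟩, abs_le.1 (hT t ht)⟩, rfl⟩
    · exact ψ.integrable.norm.mul_const _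
    · refine Eventually.of_forall fun t => ?_
      refine Tendsto.const_mul _ ?_
      have hc : ContinuousWithinAt (fun σ : ℝ => H (σ + 2 * Real.pi * l * t * Complex.I))
          (Set.Ici 0) 0 := by
        refine ContinuousWithinAt.comp (t := {z : ℂ | 0 ≤ z.re}) (hH _ (by simp)) (by fun_prop) ?_
        intro σ hσ
        simpa using hσ
      have := hc.tendsto.mono_left (nhdsWithin_mono _ Set.Ioi_subset_Ici_self)
      simpa using this
  refine tendsto_nhds_unique hleft (hright.congr' ?_)
  filter_upwards [self_mem_nhdsWithin] with σ hσ
  rw [integral_laplace_mul_fourier hF h0 ψ hσ]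
  congr 1 with t
  rw [hL _ (by simpa using hσ)]

/-- By the preceding identity this integral is a Fourier transform at frequency -lv, so
Riemann–Lebesgue applies. -/
theorem tendsto_integral_mul_fourier {F : ℝ → ℂ} {B : NNReal} (hF : LipschitzWith B F)
    (h0 : ∀ u ≤ 0, F u = 0) {H : ℂ → ℂ} (hH : ContinuousOn H {z | 0 ≤ z.re})
    (hL : ∀ z : ℂ, 0 < z.re → ∫ u : ℝ, F u * Complex.exp (-z * u) = H z)
    {ψ : 𝓢(ℝ, ℂ)} (hψ : HasCompactSupport ψ) {l : ℝ} (hl : 0 < l) :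
    Tendsto (fun v => ∫ u : ℝ, F u * (𝓕 ψ) (l * (u - v))) atTop (𝓝 0) := by
  have h := (Real.zero_at_infty_fourier
    (fun t : ℝ => ψ t * H (2 * Real.pi * l * t * Complex.I)))
  have hlim : Tendsto (fun v : ℝ => -(l * v)) atTop (cocompact ℝ) :=
    (tendsto_neg_atTop_atBot.comp (tendsto_id.const_mul_atTop hl)).mono_right
      atBot_le_cocompact
  refine (h.comp hlim).congr fun v => ?_
  rw [integral_mul_fourier_eq hF h0 hH hL hψ hl, Function.comp, Real.fourier_eq']
  congr 1 with t
  simp only [smul_eq_mul, RCLike.inner_apply, conj_trivial]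
  have : Complex.exp (((-2 * (-(l * v) * t) * Real.pi : ℝ) : ℂ) * Complex.I) =
      Complex.exp (2 * Real.pi * l * t * v * Complex.I) := by
    congr 1; push_cast; ring
  rw [← this]
  push_cast
  ring_nf

/-- A Lipschitz function supported on the positive half-line whose Laplace transform extends
continuously to the closed right half-plane tends to zero. -/
theorem tendsto_zero_of_laplace_continuousOn {F : ℝ → ℂ} {B : NNReal} (hF : LipschitzWith B F)
    (h0 : ∀ u ≤ 0, F u = 0) {H : ℂ → ℂ} (hH : ContinuousOn H {z | 0 ≤ z.re})
    (hL : ∀ z : ℂ, 0 < z.re → ∫ u : ℝ, F u * Complex.exp (-z * u) = H z) :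
    Tendsto F atTop (𝓝 0) := by
  obtain ⟨ψ, hψ, hψ0⟩ := exists_schwartz_bump
  set K : 𝓢(ℝ, ℂ) := 𝓕 ψ with hK
  have hK1 : ∫ x, K x = 1 := (integral_fourier_eq ψ).trans hψ0
  set A : ℝ := ∫ x, |x| * ‖K x‖ with hA
  have hxK : Integrable (fun x : ℝ => |x| * ‖K x‖) := by
    simpa using K.integrable_pow_mul volume 1
  have hA0 : 0 ≤ A := integral_nonneg fun x => by positivity
  -- The kernels l K(l ·) form an approximate identity, since K has integral 1. The Lipschitz bound
  -- makes the error uniform in v, so l can be fixed before v → ∞.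
  have happrox : ∀ l : ℝ, 0 < l → ∀ v : ℝ,
      ‖(l : ℂ) * (∫ u : ℝ, F u * K (l * (u - v))) - F v‖ ≤ B * A / l := by
    intro l hl v
    have hsub : (l : ℂ) * (∫ u : ℝ, F u * K (l * (u - v))) = ∫ x : ℝ, F (v + x / l) * K x := by
      have h1 : ∫ u : ℝ, F u * K (l * (u - v)) = ∫ u : ℝ, F (u + v) * K (l * u) := by
        rw [← integral_sub_right_eq_self (fun u : ℝ => F (u + v) * K (l * u)) v]
        simp
      have h2 := Measure.integral_comp_mul_left (fun x : ℝ => F (v + x / l) * K x) l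
      have h3 : ∀ u : ℝ, F (v + l * u / l) = F (u + v) := fun u => by
        rw [mul_div_cancel_left₀ _ hl.ne', add_comm]
      simp only [h3] at h2
      rw [h1, h2, abs_of_pos (inv_pos.2 hl), Complex.real_smul, ← mul_assoc]
      push_cast
      rw [mul_inv_cancel₀ (by exact_mod_cast hl.ne'), one_mul]
    have hdiff : Integrable (fun x : ℝ => (F (v + x / l) - F v) * K x) := by
      refine (hxK.const_mul (B / l)).mono' (Continuous.aestronglyMeasurable ?_)
        (Eventually.of_forall fun x => ?_)
      · have h1 := hF.continuous
        have h2 := K.continuous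
        fun_prop
      · rw [norm_mul, ← mul_assoc]
        gcongr
        have := hF.norm_sub_le (v + x / l) v
        rw [add_sub_cancel_left, Real.norm_eq_abs, abs_div, abs_of_pos hl] at this
        exact this.trans_eq (by ring)
    have hconst : Integrable (fun x : ℝ => F v * K x) := K.integrable.const_mul _
    have hsplit : ∫ x : ℝ, F (v + x / l) * K x =
        (∫ x : ℝ, (F (v + x / l) - F v) * K x) + F v := by
      have : F v = ∫ x : ℝ, F v * K x := by rw [integral_const_mul, hK1, mul_one]
      conv_rhs => rw [this]
      rw [← integral_add (by rw [← this]; exact hdiff) hconst]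
      congr 1 with x
      rw [← this]; ring
    rw [hsub, hsplit, add_sub_cancel_right]
    calc ‖∫ x : ℝ, (F (v + x / l) - F v) * K x‖ ≤ ∫ x : ℝ, B / l * (|x| * ‖K x‖) := by
          refine norm_integral_le_of_norm_le (hxK.const_mul _) (Eventually.of_forall fun x => ?_)
          rw [norm_mul, ← mul_assoc]
          gcongr
          have := hF.norm_sub_le (v + x / l) v
          rw [add_sub_cancel_left, Real.norm_eq_abs, abs_div, abs_of_pos hl] at this
          exact this.trans_eq (by ring)
      _ = B * A / l := by rw [integral_const_mul]; ring
  rw [Metric.tendsto_atTop']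
  intro ε hε
  -- Chosen so that B A / l < ε / 2; the added 1 keeps l positive when B A = 0.
  set l : ℝ := 2 * (B * A + 1) / ε with hl
  have hlpos : 0 < l := by positivity
  have hsmall : B * A / l < ε / 2 := by
    rw [hl, div_div_eq_mul_div, div_lt_div_iff₀ (by positivity) (by positivity)]
    nlinarith [B.2, mul_nonneg B.2 hA0]
  have ht := (tendsto_integral_mul_fourier hF h0 hH hL hψ hlpos).const_mul (l : ℂ)
  rw [mul_zero, Metric.tendsto_atTop'] at ht
  obtain ⟨N, hN⟩ := ht (ε / 2) (by positivity)
  refine ⟨N, fun v hv => ?_⟩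
  have h1 := hN v hv
  rw [dist_zero_right] at h1 ⊢
  have h2 := happrox l hlpos v
  calc ‖F v‖ = ‖(l : ℂ) * (∫ u : ℝ, F u * K (l * (u - v))) -
        ((l : ℂ) * (∫ u : ℝ, F u * K (l * (u - v))) - F v)‖ := by rw [sub_sub_cancel]
    _ ≤ _ := norm_sub_le _ _
    _ < ε := by linarith

end GoldstonYildirim
end

/-! ### Möbius sums over integers coprime to W -/

noncomputable section
namespace GoldstonYildirim

open ArithmeticFunction MeasureTheory
open scoped ArithmeticFunction.Moebius

/-- The indicator function of the integers coprime to `W`. -/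
def coprimeInd (W d : ℕ) : ℝ := if d.Coprime W then 1 else 0

theorem coprimeInd_nonneg (W d : ℕ) : 0 ≤ coprimeInd W d := by
  unfold coprimeInd; split_ifs <;> norm_num

theorem coprimeInd_le_one (W d : ℕ) : coprimeInd W d ≤ 1 := by
  unfold coprimeInd; split_ifs <;> norm_num

theorem coprimeInd_mul (W a b : ℕ) :
    coprimeInd W (a * b) = coprimeInd W a * coprimeInd W b := by
  simp only [coprimeInd, Nat.coprime_mul_iff_left]
  split_ifs <;> simp_all

/-- The coefficients `μ(d) / d` restricted to integers coprime to `W`. -/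
def coprimeMoebius (W d : ℕ) : ℝ := (μ d : ℝ) * coprimeInd W d / d

theorem abs_moebius_real_le_one (d : ℕ) : |(μ d : ℝ)| ≤ 1 := by
  exact_mod_cast abs_moebius_le_one (n := d)

theorem abs_coprimeMoebius_le (W d : ℕ) : |coprimeMoebius W d| ≤ 1 / d := by
  rw [coprimeMoebius, abs_div, abs_mul, abs_of_nonneg (coprimeInd_nonneg W d), Nat.abs_cast]
  gcongr
  exact mul_le_one₀ (abs_moebius_real_le_one d) (coprimeInd_nonneg _ _) (coprimeInd_le_one _ _)

/-- Expansion of a product of `1 - g p` over a finite set of primes. -/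
theorem prod_one_sub_eq_sum_divisors {R : Type*} [CommRing R] (g : ℕ → R) {P : Finset ℕ}
    (hP : ∀ p ∈ P, p.Prime) :
    ∏ p ∈ P, (1 - g p) =
      ∑ d ∈ (∏ p ∈ P, p).divisors, (μ d : R) * ∏ p ∈ d.primeFactors, g p := by
  have hsq : Squarefree (∏ p ∈ P, p) := by
    refine Finset.squarefree_prod_of_pairwise_isCoprime ?_ fun p hp => (hP p hp).squarefree
    intro p hp q hq hpq
    exact (Nat.coprime_iff_isRelPrime).1 ((Nat.coprime_primes (hP p hp) (hP q hq)).2 hpq)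
  have h := IsMultiplicative.prodPrimeFactors_one_sub_of_squarefree
    (prodPrimeFactors g) (IsMultiplicative.prodPrimeFactors g) hsq
  rw [Nat.primeFactors_prod hP] at h
  calc ∏ p ∈ P, (1 - g p) = ∏ p ∈ P, (1 - prodPrimeFactors g p) := by
        refine Finset.prod_congr rfl fun p hp => ?_
        rw [prodPrimeFactors_apply (hP p hp).ne_zero, (hP p hp).primeFactors]
        simp
    _ = _ := h
    _ = _ := by
        refine Finset.sum_congr rfl fun d hd => ?_
        rw [prodPrimeFactors_apply (Nat.pos_of_mem_divisors hd).ne']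

/-- Only squarefree divisors contribute, and these are the divisors of the radical. -/
theorem sum_divisors_moebius_eq_sum_divisors_prod {R : Type*} [CommRing R] (f : ℕ → R) {k : ℕ}
    (hk : k ≠ 0) : ∑ d ∈ k.divisors, (μ d : R) * f d =
      ∑ d ∈ (∏ p ∈ k.primeFactors, p).divisors, (μ d : R) * f d := by
  have hr : (∏ p ∈ k.primeFactors, p) ∣ k := Nat.prod_primeFactors_dvd k
  symm
  refine Finset.sum_subset (Nat.divisors_subset_of_dvd hk hr) fun d hd hd' => ?_
  have : ¬ Squarefree d := by
    intro hsq
    refine hd' (Nat.mem_divisors.2 ⟨?_, ne_zero_of_dvd_ne_zero hk hr⟩)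
    rw [← Nat.prod_primeFactors_of_squarefree hsq]
    exact Finset.prod_dvd_prod_of_subset _ _ _
      (Nat.primeFactors_mono (Nat.dvd_of_mem_divisors hd) hk)
  simp [moebius_eq_zero_of_not_squarefree this]

theorem prod_primeFactors_coprimeInd {W d : ℕ} (hd : Squarefree d) :
    ∏ p ∈ d.primeFactors, coprimeInd W p = coprimeInd W d := by
  have h : ∀ s : Finset ℕ, ∏ p ∈ s, coprimeInd W p = coprimeInd W (∏ p ∈ s, p) := by
    intro s
    induction s using Finset.induction_on with
    | empty => simp [coprimeInd]
    | insert a s ha ih => rw [Finset.prod_insert ha, Finset.prod_insert ha, coprimeInd_mul, ih]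
  rw [h, Nat.prod_primeFactors_of_squarefree hd]

theorem moebius_mul_congr_of_squarefree {R : Type*} [CommRing R] {f g : ℕ → R} {d : ℕ}
    (h : Squarefree d → f d = g d) : (μ d : R) * f d = (μ d : R) * g d := by
  by_cases hd : Squarefree d
  · rw [h hd]
  · simp [moebius_eq_zero_of_not_squarefree hd]

/-- The sum is an Euler product over p ∣ k whose factors are 0 or 1. -/
theorem abs_sum_divisors_moebius_coprimeInd_le (W : ℕ) {k : ℕ} (hk : k ≠ 0) :
    |∑ d ∈ k.divisors, (μ d : ℝ) * coprimeInd W d| ≤ 1 := by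
  rw [sum_divisors_moebius_eq_sum_divisors_prod _ hk,
    Finset.sum_congr rfl fun d _ => moebius_mul_congr_of_squarefree
      (f := coprimeInd W) (g := fun d => ∏ p ∈ d.primeFactors, coprimeInd W p)
      fun hd => (prod_primeFactors_coprimeInd hd).symm,
    ← prod_one_sub_eq_sum_divisors _ fun p hp => Nat.prime_of_mem_primeFactors hp,
    Finset.abs_prod]
  refine Finset.prod_le_one (fun _ _ => abs_nonneg _) fun p _ => ?_
  rw [abs_le]
  constructor <;> linarith [coprimeInd_nonneg W p, coprimeInd_le_one W p]

/-- Compare n ∑ μ(d)/d with ∑ μ(d) ⌊n/d⌋. The latter is a sum over k ≤ n of divisor sums of size at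
most 1, and the fractional parts cost at most another n. -/
theorem abs_sum_coprimeMoebius_le (W n : ℕ) :
    |∑ d ∈ Finset.Icc 1 n, coprimeMoebius W d| ≤ 2 := by
  rcases Nat.eq_zero_or_pos n with rfl | hn
  · simp
  have hn' : (0 : ℝ) < n := by exact_mod_cast hn
  have hfloor : ∑ d ∈ Finset.Icc 1 n, (μ d : ℝ) * coprimeInd W d * ((n / d : ℕ) : ℝ) =
      ∑ k ∈ Finset.Icc 1 n, ∑ d ∈ k.divisors, (μ d : ℝ) * coprimeInd W d := by
    have h1 : ∀ d ∈ Finset.Icc 1 n, (μ d : ℝ) * coprimeInd W d * ((n / d : ℕ) : ℝ) =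
        ∑ k ∈ Finset.Icc 1 n, if d ∣ k then (μ d : ℝ) * coprimeInd W d else 0 := by
      intro d _
      rw [← Finset.sum_filter, Finset.sum_const, nsmul_eq_mul, mul_comm]
      congr 2
      exact (Nat.Ioc_filter_dvd_card_eq_div n d).symm
    rw [Finset.sum_congr rfl h1, Finset.sum_comm]
    refine Finset.sum_congr rfl fun k hk => ?_
    rw [← Finset.sum_filter]
    congr 1
    ext d
    simp only [Finset.mem_filter, Finset.mem_Icc, Nat.mem_divisors] at hk ⊢
    constructor
    · exact fun h => ⟨h.2, by omega⟩
    · exact fun h => ⟨⟨Nat.pos_of_dvd_of_pos h.1 (by omega),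
        (Nat.le_of_dvd (by omega) h.1).trans hk.2⟩, h.1⟩
  have hA : |∑ d ∈ Finset.Icc 1 n, (μ d : ℝ) * coprimeInd W d * ((n / d : ℕ) : ℝ)| ≤ n := by
    rw [hfloor]
    refine (Finset.abs_sum_le_sum_abs _ _).trans ?_
    refine (Finset.sum_le_sum (g := fun _ => (1 : ℝ)) fun k hk =>
      abs_sum_divisors_moebius_coprimeInd_le W ?_).trans (by simp)
    have := (Finset.mem_Icc.1 hk).1; omega
  have hB : |∑ d ∈ Finset.Icc 1 n, (μ d : ℝ) * coprimeInd W d * ((n : ℝ) / d - (n / d : ℕ))| ≤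
      n := by
    refine (Finset.abs_sum_le_sum_abs _ _).trans ?_
    refine (Finset.sum_le_sum (g := fun _ => (1 : ℝ)) fun d hd => ?_).trans (by simp)
    rw [abs_mul, abs_mul, abs_of_nonneg (coprimeInd_nonneg W d)]
    refine mul_le_one₀ (mul_le_one₀ (abs_moebius_real_le_one d) (coprimeInd_nonneg _ _)
      (coprimeInd_le_one _ _)) (abs_nonneg _) ?_
    have h1 : ((n / d : ℕ) : ℝ) ≤ (n : ℝ) / d := Nat.cast_div_le
    have h2 : (n : ℝ) / d < (n / d : ℕ) + 1 := by
      rw [← Nat.floor_div_eq_div (K := ℝ)]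
      exact Nat.lt_floor_add_one _
    rw [abs_le]; constructor <;> linarith
  have hsum : (n : ℝ) * ∑ d ∈ Finset.Icc 1 n, coprimeMoebius W d =
      ∑ d ∈ Finset.Icc 1 n, (μ d : ℝ) * coprimeInd W d * ((n / d : ℕ) : ℝ) +
      ∑ d ∈ Finset.Icc 1 n, (μ d : ℝ) * coprimeInd W d * ((n : ℝ) / d - (n / d : ℕ)) := by
    rw [Finset.mul_sum, ← Finset.sum_add_distrib]
    refine Finset.sum_congr rfl fun d _ => ?_
    rw [coprimeMoebius]; ring
  have h3 : |(n : ℝ) * ∑ d ∈ Finset.Icc 1 n, coprimeMoebius W d| ≤ n * 2 := by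
    rw [hsum]
    exact (abs_add_le _ _).trans (by linarith)
  rw [abs_mul, abs_of_pos hn'] at h3
  exact le_of_mul_le_mul_left h3 hn'

/-- Abel's inequality. -/
theorem abs_sum_mul_le_of_antitone {a f : ℕ → ℝ} {B : ℝ} (hB : ∀ n, |∑ i ∈ Finset.range n, a i| ≤ B)
    (hf : Antitone f) (hf0 : ∀ i, 0 ≤ f i) (n : ℕ) :
    |∑ i ∈ Finset.range n, f i * a i| ≤ B * f 0 := by
  have h := Finset.sum_range_by_parts f a n
  simp only [smul_eq_mul] at h
  rw [h]
  calc _ ≤ |f (n - 1) * ∑ i ∈ Finset.range n, a i| +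
        |∑ i ∈ Finset.range (n - 1), (f (i + 1) - f i) * ∑ i ∈ Finset.range (i + 1), a i| :=
        abs_sub _ _
    _ ≤ f (n - 1) * B + ∑ i ∈ Finset.range (n - 1), (f i - f (i + 1)) * B := by
        refine add_le_add ?_ ((Finset.abs_sum_le_sum_abs _ _).trans
          (Finset.sum_le_sum fun i _ => ?_))
        · rw [abs_mul, abs_of_nonneg (hf0 _)]
          exact mul_le_mul_of_nonneg_left (hB _) (hf0 _)
        · rw [abs_mul, abs_sub_comm, abs_of_nonneg (sub_nonneg.2 (hf (Nat.le_succ i)))]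
          exact mul_le_mul_of_nonneg_left (hB _) (sub_nonneg.2 (hf (Nat.le_succ i)))
    _ = B * f 0 := by
        rw [← Finset.sum_mul, Finset.sum_range_sub']; ring

/-- `∑ μ(d) / d * log⁺ (x / d)` over the integers `d` coprime to `W`. -/
def moebiusLogSum (W : ℕ) (x : ℝ) : ℝ :=
  ∑ d ∈ Finset.Icc 1 ⌊x⌋₊, coprimeMoebius W d * Real.posLog (x / d)

theorem posLog_div_eq_zero {x : ℝ} {d : ℕ} (h : ⌊x⌋₊ < d) (hx : 0 ≤ x) :
    Real.posLog (x / d) = 0 := by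
  have hd : (0 : ℝ) < d := by exact_mod_cast (Nat.zero_le _).trans_lt h
  rw [Real.posLog_eq_zero_iff, abs_of_nonneg (by positivity), div_le_one hd]
  exact ((Nat.floor_lt hx).1 h).le

theorem moebiusLogSum_eq_of_le (W : ℕ) {x : ℝ} (hx : 0 ≤ x) {n : ℕ} (hn : ⌊x⌋₊ ≤ n) :
    moebiusLogSum W x = ∑ d ∈ Finset.Icc 1 n, coprimeMoebius W d * Real.posLog (x / d) := by
  refine Finset.sum_subset (Finset.Icc_subset_Icc_right hn) fun d hd hd' => ?_
  rw [posLog_div_eq_zero _ hx, mul_zero]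
  simp only [Finset.mem_Icc, not_and, not_le] at hd hd'
  exact hd' hd.1

theorem posLog_exp_div (u : ℝ) {d : ℕ} (hd : 0 < d) :
    Real.posLog (Real.exp u / d) = max 0 (u - Real.log d) := by
  rw [Real.posLog_apply, Real.log_div (Real.exp_ne_zero _) (by exact_mod_cast hd.ne'),
    Real.log_exp]

theorem moebiusLogSum_exp_of_nonpos (W : ℕ) {u : ℝ} (hu : u ≤ 0) :
    moebiusLogSum W (Real.exp u) = 0 := by
  refine Finset.sum_eq_zero fun d hd => ?_
  have hd1 := (Finset.mem_Icc.1 hd).1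
  rw [posLog_exp_div u hd1, max_eq_left, mul_zero]
  have : 0 ≤ Real.log d := Real.log_natCast_nonneg d
  linarith

/-- The increment of log⁺ between the two arguments is nonnegative, decreasing in d and at most v -
u at d = 1, so Abel's inequality applies with the bound 2 for partial sums of μ(d)/d. This is the
Lipschitz hypothesis of the Tauberian theorem. -/
theorem abs_moebiusLogSum_exp_sub_le (W : ℕ) {u v : ℝ} (huv : u ≤ v) :
    |moebiusLogSum W (Real.exp v) - moebiusLogSum W (Real.exp u)| ≤ 2 * (v - u) := by
  set n := ⌊Real.exp v⌋₊
  rw [moebiusLogSum_eq_of_le W (Real.exp_pos v).le (le_refl n),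
    moebiusLogSum_eq_of_le W (Real.exp_pos u).le
      (Nat.floor_le_floor (Real.exp_le_exp.2 huv) : _ ≤ n), ← Finset.sum_sub_distrib]
  set f : ℕ → ℝ := fun i =>
    max 0 (v - Real.log (i + 1 : ℕ)) - max 0 (u - Real.log (i + 1 : ℕ)) with hf
  have hmono : ∀ s t : ℝ, s ≤ t → max 0 (v - t) - max 0 (u - t) ≤ max 0 (v - s) - max 0 (u - s) := by
    intro s t hst
    rcases le_total 0 (v - t) with h1 | h1 <;> rcases le_total 0 (u - t) with h2 | h2 <;>
    rcases le_total 0 (v - s) with h3 | h3 <;> rcases le_total 0 (u - s) with h4 | h4 <;>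
    simp only [h1, h2, h3, h4, max_eq_left, max_eq_right] <;> linarith
  have hanti : Antitone f := by
    intro i j hij
    refine hmono _ _ (Real.log_le_log (by positivity) ?_)
    exact_mod_cast Nat.succ_le_succ hij
  have hf0 : ∀ i, 0 ≤ f i := fun i => sub_nonneg.2 (max_le_max le_rfl (by linarith))
  have hf00 : f 0 ≤ v - u := by
    simp only [hf, zero_add, Nat.cast_one, Real.log_one, sub_zero]
    rcases le_total 0 v with h1 | h1 <;> rcases le_total 0 u with h2 | h2 <;>
    simp only [h1, h2, max_eq_left, max_eq_right] <;> linarith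
  have hsum : ∀ g : ℕ → ℝ, ∑ d ∈ Finset.Icc 1 n, g d = ∑ i ∈ Finset.range n, g (i + 1) := by
    intro g
    rw [Finset.range_eq_Ico, Finset.sum_Ico_add' g 0 n 1]
    rfl
  have hB : ∀ k, |∑ i ∈ Finset.range k, coprimeMoebius W (i + 1)| ≤ 2 := by
    intro k
    rw [Finset.range_eq_Ico, Finset.sum_Ico_add' (coprimeMoebius W) 0 k 1]
    exact abs_sum_coprimeMoebius_le W k
  calc _ = |∑ i ∈ Finset.range n, f i * coprimeMoebius W (i + 1)| := by
        rw [hsum]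
        congr 1
        refine Finset.sum_congr rfl fun i _ => ?_
        rw [posLog_exp_div _ (Nat.succ_pos i), posLog_exp_div _ (Nat.succ_pos i)]
        ring
    _ ≤ 2 * f 0 := abs_sum_mul_le_of_antitone hB hanti hf0 n
    _ ≤ _ := by linarith

end GoldstonYildirim
end

/-! ### Laplace transform and limit of the logarithmic Möbius sum -/

noncomputable section
namespace GoldstonYildirim

open ArithmeticFunction MeasureTheory
open scoped ArithmeticFunction.Moebius

theorem lipschitzWith_max_sub (l : ℝ) :
    LipschitzWith 1 (fun u : ℝ => ((max 0 (u - l) : ℝ) : ℂ)) := by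
  refine LipschitzWith.of_dist_le_mul fun x y => ?_
  rw [dist_eq_norm, ← Complex.ofReal_sub, Complex.norm_real, Real.norm_eq_abs, Real.dist_eq,
    NNReal.coe_one, one_mul, max_comm, max_comm 0]
  simpa using abs_max_sub_max_le_abs (x - l) (y - l) 0

theorem integral_max_zero_mul_exp_neg {z : ℂ} (hz : 0 < z.re) :
    ∫ u : ℝ, ((max 0 u : ℝ) : ℂ) * Complex.exp (-z * u) = 1 / z ^ 2 := by
  have hz0 : z ≠ 0 := fun h => by simp [h] at hz
  have hint := integrable_mul_exp_neg (lipschitzWith_max_sub 0)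
    (fun u hu => by rw [max_eq_left (by linarith)]; simp) hz
  have hEq : Set.EqOn (fun u : ℝ => ((max 0 (u - 0) : ℝ) : ℂ) * Complex.exp (-z * u))
      (fun u : ℝ => (u : ℂ) * Complex.exp (-z * u)) (Set.Ioi 0) := by
    intro u hu
    simp only [sub_zero, max_eq_right (le_of_lt (Set.mem_Ioi.1 hu))]
  have h2 : ∫ u : ℝ, ((max 0 u : ℝ) : ℂ) * Complex.exp (-z * u) =
      ∫ u in Set.Ioi (0 : ℝ), (u : ℂ) * Complex.exp (-z * u) := by
    rw [← integral_indicator measurableSet_Ioi]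
    congr 1 with u
    rcases le_or_gt u 0 with hu | hu
    · simp [hu, Set.indicator, not_lt.2 hu]
    · rw [Set.indicator_of_mem (Set.mem_Ioi.2 hu), max_eq_right hu.le]
  have hlim : Tendsto (fun u : ℝ => -((u : ℂ) / z + 1 / z ^ 2) * Complex.exp (-z * u)) atTop
      (𝓝 0) := by
    have hexp : ∀ s : ℝ, Tendsto (fun u : ℝ => u ^ s * Real.exp (-z.re * u)) atTop (𝓝 0) :=
      fun s => tendsto_rpow_mul_exp_neg_mul_atTop_nhds_zero s _ hz
    have h0 : Tendsto (fun u : ℝ => ‖z‖⁻¹ * (u ^ (1 : ℝ) * Real.exp (-z.re * u)) +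
        ‖z ^ 2‖⁻¹ * (u ^ (0 : ℝ) * Real.exp (-z.re * u))) atTop (𝓝 0) := by
      simpa only [mul_zero, add_zero] using
        ((hexp 1).const_mul ‖z‖⁻¹).add ((hexp 0).const_mul ‖z ^ 2‖⁻¹)
    refine squeeze_zero_norm' ?_ h0
    filter_upwards [eventually_ge_atTop 0] with u hu
    rw [norm_mul, norm_neg, Complex.norm_exp, Real.rpow_one, Real.rpow_zero]
    have h4 : (-z * (u : ℂ)).re = -z.re * u := by simp
    rw [h4]
    calc _ ≤ (‖(u : ℂ) / z‖ + ‖1 / z ^ 2‖) * Real.exp (-z.re * u) := by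
          gcongr; exact norm_add_le _ _
      _ = _ := by
          rw [norm_div, norm_div, Complex.norm_real, Real.norm_of_nonneg hu, norm_one]; ring
  have hderiv : ∀ u ∈ Set.Ici (0 : ℝ), HasDerivAt
      (fun u : ℝ => -((u : ℂ) / z + 1 / z ^ 2) * Complex.exp (-z * u))
      ((u : ℂ) * Complex.exp (-z * u)) u := by
    intro u _
    have h5 : HasDerivAt (fun u : ℝ => (u : ℂ)) 1 u := Complex.ofRealCLM.hasDerivAt
    have h6 := (((h5.div_const z).add_const (1 / z ^ 2)).neg).mul ((h5.const_mul (-z)).cexp)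
    convert! h6 using 1
    simp only [Pi.neg_apply]
    field_simp
    ring
  rw [h2, integral_Ioi_of_hasDerivAt_of_tendsto' hderiv
    ((integrableOn_congr_fun hEq measurableSet_Ioi).1 hint.integrableOn) hlim]
  simp

theorem integral_max_mul_exp_neg (l : ℝ) {z : ℂ} (hz : 0 < z.re) :
    ∫ u : ℝ, ((max 0 (u - l) : ℝ) : ℂ) * Complex.exp (-z * u) = Complex.exp (-z * l) / z ^ 2 := by
  have h1 : ∫ u : ℝ, ((max 0 (u - l) : ℝ) : ℂ) * Complex.exp (-z * u) =
      ∫ u : ℝ, ((max 0 u : ℝ) : ℂ) * (Complex.exp (-z * u) * Complex.exp (-z * l)) := by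
    rw [← integral_add_right_eq_self _ l]
    congr 1 with u
    rw [add_sub_cancel_right, ← Complex.exp_add]
    congr 2; push_cast; ring
  rw [h1]
  simp only [← mul_assoc]
  rw [integral_mul_const, integral_max_zero_mul_exp_neg hz]
  ring

theorem integrable_max_mul_exp_neg {l : ℝ} (hl : 0 ≤ l) {z : ℂ} (hz : 0 < z.re) :
    Integrable fun u : ℝ => ((max 0 (u - l) : ℝ) : ℂ) * Complex.exp (-z * u) :=
  integrable_mul_exp_neg (lipschitzWith_max_sub l)
    (fun u hu => by rw [max_eq_left (by linarith)]; simp) hz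

theorem integral_norm_max_mul_exp_neg (l : ℝ) {z : ℂ} (hz : 0 < z.re) :
    ∫ u : ℝ, ‖((max 0 (u - l) : ℝ) : ℂ) * Complex.exp (-z * u)‖ =
      Real.exp (-z.re * l) / z.re ^ 2 := by
  have h := integral_max_mul_exp_neg l (z := (z.re : ℂ)) (by simpa using hz)
  have h2 : ∀ u : ℝ, ((max 0 (u - l) : ℝ) : ℂ) * Complex.exp (-(z.re : ℂ) * u) =
      ((‖((max 0 (u - l) : ℝ) : ℂ) * Complex.exp (-z * u)‖ : ℝ) : ℂ) := by
    intro u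
    rw [norm_mul, Complex.norm_exp, Complex.norm_real, Real.norm_of_nonneg (le_max_left _ _)]
    push_cast
    congr 2
    simp
  simp only [h2] at h
  apply Complex.ofReal_injective
  refine (integral_ofReal (𝕜 := ℂ)).symm.trans (h.trans ?_)
  push_cast; rfl

theorem hasSum_moebiusLogSum (W : ℕ) (u : ℝ) :
    HasSum (fun d : ℕ => coprimeMoebius W d * max 0 (u - Real.log d))
      (moebiusLogSum W (Real.exp u)) := by
  have h : moebiusLogSum W (Real.exp u) = ∑ d ∈ Finset.Icc 1 ⌊Real.exp u⌋₊,
      coprimeMoebius W d * max 0 (u - Real.log d) := by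
    refine Finset.sum_congr rfl fun d hd => ?_
    rw [posLog_exp_div _ (Finset.mem_Icc.1 hd).1]
  rw [h]
  refine hasSum_sum_of_ne_finset_zero fun d hd => ?_
  rcases Nat.eq_zero_or_pos d with rfl | hd0
  · simp [coprimeMoebius]
  · rw [← posLog_exp_div _ hd0, posLog_div_eq_zero _ (Real.exp_pos u).le, mul_zero]
    simp only [Finset.mem_Icc, not_and, not_le] at hd
    exact hd hd0

theorem coprimeMoebius_mul_exp (W : ℕ) [NeZero W] (z : ℂ) (d : ℕ) :
    (coprimeMoebius W d : ℂ) * Complex.exp (-z * Real.log d) =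
      LSeries.term ((fun n : ℕ => (1 : DirichletCharacter ℂ W) n) *
        (fun n : ℕ => ((μ n : ℤ) : ℂ))) (1 + z) d := by
  rcases Nat.eq_zero_or_pos d with rfl | hd
  · simp [coprimeMoebius]
  have hd0 : (d : ℂ) ≠ 0 := by exact_mod_cast hd.ne'
  rw [LSeries.term_of_ne_zero hd.ne', Complex.cpow_add _ _ hd0, Complex.cpow_one,
    Complex.cpow_def_of_ne_zero hd0, neg_mul, Complex.exp_neg, ← Complex.natCast_log,
    mul_comm z, coprimeMoebius, Pi.mul_apply]
  have : (1 : DirichletCharacter ℂ W) d = ((coprimeInd W d : ℝ) : ℂ) := by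
    unfold coprimeInd
    split_ifs with h
    · rw [MulChar.one_apply ((ZMod.isUnit_iff_coprime d W).2 h)]; simp
    · rw [MulChar.map_nonunit _ (fun h' => h ((ZMod.isUnit_iff_coprime d W).1 h'))]; simp
  rw [this]
  push_cast
  field_simp

/-- The ramp starting at log d has transform d^{-z} / z². Absolute convergence for Re z > 0 allows
termwise integration, and the resulting Dirichlet series is the reciprocal of L(1 + z, χ₀). -/
theorem laplace_moebiusLogSum (W : ℕ) [NeZero W] {z : ℂ} (hz : 0 < z.re) :
    ∫ u : ℝ, (moebiusLogSum W (Real.exp u) : ℂ) * Complex.exp (-z * u) =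
      1 / (z ^ 2 * DirichletCharacter.LFunctionTrivChar W (1 + z)) := by
  have hre : 1 < (1 + z).re := by simpa using hz
  have hlog : ∀ d : ℕ, 0 ≤ Real.log d := Real.log_natCast_nonneg
  have hsummable : Summable fun d : ℕ => ∫ u : ℝ, ‖(coprimeMoebius W d : ℂ) *
      (((max 0 (u - Real.log d) : ℝ) : ℂ) * Complex.exp (-z * u))‖ := by
    have h : ∀ d : ℕ, ∫ u : ℝ, ‖(coprimeMoebius W d : ℂ) *
        (((max 0 (u - Real.log d) : ℝ) : ℂ) * Complex.exp (-z * u))‖ =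
        |coprimeMoebius W d| * Real.exp (-z.re * Real.log d) / z.re ^ 2 := by
      intro d
      simp only [norm_mul (coprimeMoebius W d : ℂ), Complex.norm_real, Real.norm_eq_abs]
      rw [integral_const_mul, integral_norm_max_mul_exp_neg (Real.log d) hz]
      ring
    simp only [h]
    refine Summable.div_const ?_ _
    refine Summable.of_nonneg_of_le (fun d => by positivity) (fun d => ?_)
      (Real.summable_one_div_nat_rpow.2 hre)
    rcases Nat.eq_zero_or_pos d with rfl | hd
    · simp [coprimeMoebius]; positivity
    have hd0 : (0 : ℝ) < d := by exact_mod_cast hd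
    calc |coprimeMoebius W d| * Real.exp (-z.re * Real.log d)
        ≤ 1 / d * Real.exp (-z.re * Real.log d) := by
          gcongr; exact abs_coprimeMoebius_le W d
      _ = _ := by
          rw [Complex.add_re, Complex.one_re, Real.rpow_add hd0, Real.rpow_one,
            Real.rpow_def_of_pos hd0, neg_mul, Real.exp_neg, mul_comm z.re]
          field_simp
  have hsum := hasSum_integral_of_summable_integral_norm
    (fun d : ℕ => (integrable_max_mul_exp_neg (hlog d) hz).const_mul (coprimeMoebius W d : ℂ))
    hsummable
  have hL : DirichletCharacter.LFunctionTrivChar W (1 + z) *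
      LSeries ((fun n : ℕ => (1 : DirichletCharacter ℂ W) n) *
        (fun n : ℕ => ((μ n : ℤ) : ℂ))) (1 + z) = 1 := by
    rw [DirichletCharacter.LFunctionTrivChar, DirichletCharacter.LFunction_eq_LSeries _ hre]
    exact DirichletCharacter.LSeries.mul_mu_eq_one _ hre
  have hterm : ∀ d : ℕ, ∫ u : ℝ, (coprimeMoebius W d : ℂ) *
      (((max 0 (u - Real.log d) : ℝ) : ℂ) * Complex.exp (-z * u)) =
      LSeries.term ((fun n : ℕ => (1 : DirichletCharacter ℂ W) n) *
        (fun n : ℕ => ((μ n : ℤ) : ℂ))) (1 + z) d / z ^ 2 := by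
    intro d
    rw [integral_const_mul, integral_max_mul_exp_neg (Real.log d) hz, ← coprimeMoebius_mul_exp]
    ring
  have hpoint : ∀ u : ℝ, ∑' d : ℕ, (coprimeMoebius W d : ℂ) *
      (((max 0 (u - Real.log d) : ℝ) : ℂ) * Complex.exp (-z * u)) =
      (moebiusLogSum W (Real.exp u) : ℂ) * Complex.exp (-z * u) := by
    intro u
    refine HasSum.tsum_eq ?_
    have := (Complex.hasSum_ofReal.2 (hasSum_moebiusLogSum W u)).mul_right (Complex.exp (-z * u))
    simpa [mul_assoc] using this
  simp only [hterm, hpoint] at hsum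
  rw [← hsum.tsum_eq, tsum_div_const]
  change LSeries _ _ / _ = _
  have hne : DirichletCharacter.LFunctionTrivChar W (1 + z) ≠ 0 := left_ne_zero_of_mul_eq_one hL
  have hz0 : z ≠ 0 := fun h => by simp [h] at hz
  field_simp
  linear_combination hL

/-- The entire function `z L(1 + z, χ₀)`. -/
theorem zL_ne_zero (W : ℕ) [NeZero W] {z : ℂ} (hz : 0 ≤ z.re) :
    DirichletCharacter.LFunctionTrivChar₁ W (1 + z) ≠ 0 := by
  rcases eq_or_ne z 0 with rfl | hz0
  · rw [add_zero]
    exact DirichletCharacter.LFunctionTrivChar₁_apply_one_ne_zero W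
  · have h1 : 1 + z ≠ 1 := by simpa using hz0
    rw [DirichletCharacter.LFunctionTrivChar₁, Function.update_of_ne h1]
    exact mul_ne_zero (by simpa using hz0)
      (DirichletCharacter.LFunction_ne_zero_of_one_le_re _ (.inr h1) (by simpa using hz))

theorem LFunctionTrivChar₁_one_eq (W : ℕ) [NeZero W] :
    DirichletCharacter.LFunctionTrivChar₁ W 1 = (((W.totient : ℝ) / W : ℝ) : ℂ) := by
  have hW : (W : ℂ) ≠ 0 := by exact_mod_cast NeZero.ne W
  have h := congrArg (fun q : ℚ => (q : ℂ)) (Nat.totient_eq_mul_prod_factors W)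
  rw [DirichletCharacter.LFunctionTrivChar₁, Function.update_self]
  push_cast at h ⊢
  rw [h]; field_simp

theorem one_sub_exp_eq_zero {u : ℝ} (hu : u ≤ 0) : 1 - Real.exp (-max 0 u) = 0 := by
  simp [max_eq_left hu]

theorem lipschitzWith_one_sub_exp : LipschitzWith 1 (fun u : ℝ => 1 - Real.exp (-max 0 u)) := by
  refine LipschitzWith.of_le_add_mul _ fun x y => ?_
  rw [NNReal.coe_one, one_mul, Real.dist_eq]
  have h1 : max 0 x - max 0 y ≤ |x - y| := by
    have := abs_max_sub_max_le_abs x y 0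
    rw [max_comm, max_comm y] at this
    exact (le_abs_self _).trans this
  rcases le_total (max 0 x) (max 0 y) with h | h
  · have := Real.exp_le_exp.2 (neg_le_neg h)
    linarith [abs_nonneg (x - y)]
  · have h2 : Real.exp (-max 0 y) - Real.exp (-max 0 x) ≤ max 0 x - max 0 y := by
      have h3 := Real.add_one_le_exp (max 0 y - max 0 x)
      have h4 : Real.exp (-max 0 x) = Real.exp (-max 0 y) * Real.exp (max 0 y - max 0 x) := by
        rw [← Real.exp_add]; congr 1; ring
      have h5 : Real.exp (-max 0 y) ≤ 1 := Real.exp_le_one_iff.2 (by simp)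
      rw [h4]
      nlinarith [Real.exp_pos (-max 0 y)]
    linarith

/-- A comparison function with limit 1: Lipschitz, zero for u ≤ 0, and with a transform whose simple
pole at 0 cancels that of the Möbius sum after scaling. -/
theorem laplace_one_sub_exp {z : ℂ} (hz : 0 < z.re) :
    ∫ u : ℝ, ((1 - Real.exp (-max 0 u) : ℝ) : ℂ) * Complex.exp (-z * u) = 1 / (z * (z + 1)) := by
  have hz0 : z ≠ 0 := fun h => by simp [h] at hz
  have hz1 : z + 1 ≠ 0 := fun h => by
    have := congrArg Complex.re h
    simp at this; linarith
  have h2 : ∫ u : ℝ, ((1 - Real.exp (-max 0 u) : ℝ) : ℂ) * Complex.exp (-z * u) =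
      ∫ u in Set.Ioi (0 : ℝ), (Complex.exp (-z * u) - Complex.exp (-(z + 1) * u)) := by
    rw [← integral_indicator measurableSet_Ioi]
    congr 1 with u
    rcases le_or_gt u 0 with hu | hu
    · simp [hu, Set.indicator, not_lt.2 hu]
    · rw [Set.indicator_of_mem (Set.mem_Ioi.2 hu), max_eq_right hu.le]
      push_cast
      rw [sub_mul, one_mul, ← Complex.exp_add]
      congr 2; ring
  rw [h2, integral_sub (integrableOn_exp_mul_complex_Ioi (by simpa using hz) 0)
    (integrableOn_exp_mul_complex_Ioi (by simp; linarith) 0),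
    integral_exp_mul_complex_Ioi (by simpa using hz),
    integral_exp_mul_complex_Ioi (by simp; linarith)]
  simp only [Complex.ofReal_zero, mul_zero, Complex.exp_zero]
  have : -(z + 1) ≠ 0 := neg_ne_zero.2 hz1
  field_simp
  ring

/-- After subtracting c (1 - exp(-u⁺)) the Laplace transform is g(z)/z, with g holomorphic at every
point of the closed half-plane because z L(1 + z, χ₀) has no zero there. The value φ(W)/W of that
function at z = 0 gives g(0) = 0, so the Tauberian theorem applies. -/
theorem tendsto_moebiusLogSum (W : ℕ) [NeZero W] :
    Tendsto (fun x : ℝ => moebiusLogSum W x) atTop (𝓝 ((W : ℝ) / W.totient)) := by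
  set c : ℝ := (W : ℝ) / W.totient with hc
  set g : ℂ → ℂ := fun z => (DirichletCharacter.LFunctionTrivChar₁ W (1 + z))⁻¹ - c / (z + 1)
    with hg
  set F : ℝ → ℝ := fun u => moebiusLogSum W (Real.exp u) - c * (1 - Real.exp (-max 0 u)) with hF
  have hc0 : 0 ≤ c := by positivity
  have hlip : LipschitzWith (2 + c).toNNReal (fun u => (F u : ℂ)) := by
    have h : LipschitzWith (2 + c).toNNReal F := by
      refine LipschitzWith.of_dist_le_mul fun x y => ?_
      rw [Real.coe_toNNReal _ (by positivity)]
      have h1 : |moebiusLogSum W (Real.exp x) - moebiusLogSum W (Real.exp y)| ≤ 2 * |x - y| := by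
        rcases le_total x y with h | h
        · rw [abs_sub_comm, abs_sub_comm x, abs_of_nonneg (sub_nonneg.2 h)]
          exact abs_moebiusLogSum_exp_sub_le W h
        · rw [abs_of_nonneg (sub_nonneg.2 h)]
          exact abs_moebiusLogSum_exp_sub_le W h
      have h2 := lipschitzWith_one_sub_exp.dist_le_mul x y
      rw [NNReal.coe_one, one_mul, Real.dist_eq, Real.dist_eq] at h2
      rw [Real.dist_eq, Real.dist_eq]
      calc |F x - F y| = |(moebiusLogSum W (Real.exp x) - moebiusLogSum W (Real.exp y)) -
            c * ((1 - Real.exp (-max 0 x)) - (1 - Real.exp (-max 0 y)))| := by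
            simp only [hF]; congr 1; ring
        _ ≤ _ := abs_sub _ _
        _ ≤ 2 * |x - y| + c * |x - y| := by
            rw [abs_mul, abs_of_nonneg hc0]
            gcongr
        _ = _ := by ring
    refine LipschitzWith.of_dist_le_mul fun x y => ?_
    rw [dist_eq_norm, ← Complex.ofReal_sub, Complex.norm_real]
    exact h.dist_le_mul x y
  have hF0 : ∀ u ≤ 0, (F u : ℂ) = 0 := by
    intro u hu
    simp only [hF]
    rw [moebiusLogSum_exp_of_nonpos W hu, one_sub_exp_eq_zero hu]; simp
  have hdiff : ∀ z : ℂ, 0 ≤ z.re → DifferentiableAt ℂ g z := by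
    intro z hz
    have hz1 : z + 1 ≠ 0 := fun h => by
      have := congrArg Complex.re h
      simp at this; linarith
    refine DifferentiableAt.sub (DifferentiableAt.inv ?_ (zL_ne_zero W hz))
      (DifferentiableAt.div (by fun_prop) (by fun_prop) hz1)
    exact (DirichletCharacter.differentiable_LFunctionTrivChar₁ W).differentiableAt.comp z
      (by fun_prop)
  have hg0 : g 0 = 0 := by
    simp only [hg, add_zero, zero_add, div_one, LFunctionTrivChar₁_one_eq, hc]
    push_cast
    field_simp
    simp
  -- `dslope g 0` is g(z)/z with its removable singularity filled in.
  have hH : ContinuousOn (dslope g 0) {z | 0 ≤ z.re} := by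
    intro z hz
    rcases eq_or_ne z 0 with rfl | hz0
    · exact (continuousAt_dslope_same.2 (hdiff 0 (by simp))).continuousWithinAt
    · exact ((continuousAt_dslope_of_ne hz0).2 (hdiff z hz).continuousAt).continuousWithinAt
  have hL : ∀ z : ℂ, 0 < z.re →
      ∫ u : ℝ, (F u : ℂ) * Complex.exp (-z * u) = dslope g 0 z := by
    intro z hz
    have hz0 : z ≠ 0 := fun h => by simp [h] at hz
    have hz1 : z + 1 ≠ 0 := fun h => by
      have := congrArg Complex.re h
      simp at this; linarith
    have hi2 : Integrable fun u : ℝ => ((1 - Real.exp (-max 0 u) : ℝ) : ℂ) *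
        Complex.exp (-z * u) := by
      refine integrable_mul_exp_neg (B := 1) ?_
        (fun u hu => by rw [one_sub_exp_eq_zero hu]; simp) hz
      refine LipschitzWith.of_dist_le_mul fun x y => ?_
      rw [dist_eq_norm, ← Complex.ofReal_sub, Complex.norm_real]
      exact lipschitzWith_one_sub_exp.dist_le_mul x y
    have hsplit : ∀ u : ℝ, (F u : ℂ) * Complex.exp (-z * u) +
        c * (((1 - Real.exp (-max 0 u) : ℝ) : ℂ) * Complex.exp (-z * u)) =
        (moebiusLogSum W (Real.exp u) : ℂ) * Complex.exp (-z * u) := by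
      intro u; simp only [hF]; push_cast; ring
    have h3 : ∫ u : ℝ, (moebiusLogSum W (Real.exp u) : ℂ) * Complex.exp (-z * u) =
        (∫ u : ℝ, (F u : ℂ) * Complex.exp (-z * u)) + c * (1 / (z * (z + 1))) := by
      rw [← laplace_one_sub_exp hz, ← integral_const_mul,
        ← integral_add (integrable_mul_exp_neg hlip hF0 hz) (hi2.const_mul (c : ℂ))]
      congr 1 with u
      exact (hsplit u).symm
    rw [laplace_moebiusLogSum W hz] at h3
    have h4 : ∫ u : ℝ, (F u : ℂ) * Complex.exp (-z * u) =
        1 / (z ^ 2 * DirichletCharacter.LFunctionTrivChar W (1 + z)) - c * (1 / (z * (z + 1))) := by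
      rw [h3]; ring
    have hne : 1 + z ≠ 1 := by simpa using hz0
    have hLne := zL_ne_zero W hz.le
    have hLz : DirichletCharacter.LFunctionTrivChar₁ W (1 + z) =
        z * DirichletCharacter.LFunctionTrivChar W (1 + z) := by
      rw [DirichletCharacter.LFunctionTrivChar₁, Function.update_of_ne hne]; ring
    rw [hLz] at hLne
    rw [h4, dslope_of_ne g hz0, slope_def_field, hg0, sub_zero, sub_zero]
    simp only [hg]
    rw [hLz]
    field_simp
  have hlim := tendsto_zero_of_laplace_continuousOn hlip hF0 hH hL
  have hlimR : Tendsto F atTop (𝓝 0) := by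
    have := (Complex.continuous_re.tendsto 0).comp hlim
    simpa [Function.comp_def] using this
  have hexp : Tendsto (fun u : ℝ => c * (1 - Real.exp (-max 0 u))) atTop (𝓝 c) := by
    have h1 : Tendsto (fun u : ℝ => Real.exp (-max 0 u)) atTop (𝓝 0) :=
      (Real.tendsto_exp_neg_atTop_nhds_zero).comp
        (tendsto_atTop_mono (fun u => le_max_right 0 u) tendsto_id)
    simpa using (h1.const_sub 1).const_mul c
  have hmain : Tendsto (fun u : ℝ => moebiusLogSum W (Real.exp u)) atTop (𝓝 c) := by
    have := hlimR.add hexp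
    simpa [hF] using this
  refine (hmain.comp Real.tendsto_log_atTop).congr' ?_
  filter_upwards [eventually_gt_atTop 0] with x hx
  rw [Function.comp, Real.exp_log hx]

end GoldstonYildirim
end

/-! ### Upper bound for the pair sums -/

noncomputable section
namespace GoldstonYildirim

theorem coprimeInd_mul_add (W j r : ℕ) : coprimeInd W (W * j + r) = coprimeInd W r := by
  unfold coprimeInd
  have : (W * j + r).Coprime W ↔ r.Coprime W := by
    rw [Nat.Coprime, Nat.Coprime, Nat.gcd_comm, Nat.gcd_comm r, Nat.gcd_mul_left_add_right]
  simp [this]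

theorem sum_range_coprimeInd (W : ℕ) :
    ∑ r ∈ Finset.range W, coprimeInd W r = W.totient := by
  simp only [coprimeInd, Finset.sum_boole, Nat.totient]
  congr 2
  ext r
  simp [Nat.coprime_comm]

/-- Cut into blocks of length W. The first is bounded trivially by W; each later block has φ(W)
nonzero terms, of size at most 1 / (W (j + 1)). -/
theorem sum_range_coprimeInd_div_le (W : ℕ) [NeZero W] (J : ℕ) :
    ∑ n ∈ Finset.range (W * (J + 1)), coprimeInd W n / n ≤
      W + (W.totient : ℝ) / W * ∑ j ∈ Finset.range J, ((j : ℝ) + 1)⁻¹ := by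
  have hW : (0 : ℝ) < W := by exact_mod_cast NeZero.pos W
  induction J with
  | zero =>
    simp only [zero_add, mul_one, Finset.range_zero, Finset.sum_empty, mul_zero, add_zero]
    calc _ ≤ ∑ n ∈ Finset.range W, (1 : ℝ) := by
          refine Finset.sum_le_sum fun n _ => ?_
          rcases Nat.eq_zero_or_pos n with rfl | hn
          · simp
          · rw [div_le_one (by exact_mod_cast hn)]
            exact (coprimeInd_le_one W n).trans (by exact_mod_cast hn)
      _ = W := by simp
  | succ J ih =>
    rw [mul_add_one W (J + 1), Finset.sum_range_add, Finset.sum_range_succ _ J,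
      mul_add ((W.totient : ℝ) / W), ← add_assoc]
    refine add_le_add ih ?_
    rw [← sum_range_coprimeInd, Finset.sum_div, Finset.sum_mul]
    refine Finset.sum_le_sum fun r _ => ?_
    rw [coprimeInd_mul_add, div_mul_eq_mul_div, div_eq_mul_inv, mul_div_assoc, div_eq_mul_inv,
      ← mul_inv]
    refine mul_le_mul_of_nonneg_left ?_ (coprimeInd_nonneg W r)
    refine inv_anti₀ (by positivity) ?_
    push_cast
    have : (0 : ℝ) ≤ r := by positivity
    nlinarith

theorem sum_coprimeInd_div_le (W : ℕ) [NeZero W] {x : ℝ} (hx : 1 ≤ x) :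
    ∑ n ∈ Finset.Icc 1 ⌊x⌋₊, coprimeInd W n / n ≤
      W + (W.totient : ℝ) / W * (1 + Real.log x) := by
  have hW : 0 < W := NeZero.pos W
  set N := ⌊x⌋₊ with hN
  have hN1 : 1 ≤ N := Nat.le_floor (by simpa using hx)
  calc _ ≤ ∑ n ∈ Finset.range (W * (N + 1)), coprimeInd W n / n := by
        refine Finset.sum_le_sum_of_subset_of_nonneg (fun n hn => ?_)
          fun n _ _ => div_nonneg (coprimeInd_nonneg W n) (by positivity)
        rw [Finset.mem_Icc] at hn
        rw [Finset.mem_range]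
        nlinarith
    _ ≤ _ := sum_range_coprimeInd_div_le W N
    _ ≤ _ := by
        gcongr
        have h := harmonic_le_one_add_log N
        rw [harmonic] at h
        push_cast at h
        refine h.trans ?_
        gcongr
        exact Nat.floor_le (by linarith)

theorem moebiusLogSum_of_lt_one (W : ℕ) {x : ℝ} (hx : x < 1) : moebiusLogSum W x = 0 := by
  rw [moebiusLogSum, Nat.floor_eq_zero.2 hx]; simp

theorem abs_moebiusLogSum_le_log (W : ℕ) {x : ℝ} (hx : 1 ≤ x) :
    |moebiusLogSum W x| ≤ 2 * Real.log x := by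
  have h := abs_moebiusLogSum_exp_sub_le W (Real.log_nonneg hx)
  rwa [Real.exp_log (by linarith), moebiusLogSum_exp_of_nonpos W le_rfl, sub_zero, sub_zero] at h

/-- The logarithmic average `∑ n⁻¹ M(R / (a n)) M(R / (b n))` over `n ≤ R` coprime to `W`,
where `M` is `moebiusLogSum W`. -/
def pairSum (W : ℕ) (R : ℝ) (a b : ℕ) : ℝ :=
  ∑ n ∈ Finset.Icc 1 ⌊R⌋₊, coprimeInd W n / n *
    (moebiusLogSum W (R / ((a * n : ℕ) : ℝ)) * moebiusLogSum W (R / ((b * n : ℕ) : ℝ)))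

/-- There are at most y such n, each with 1/n ≤ X/y. The bound is independent of y, which gives
uniformity in the dilation parameters a and b. -/
theorem sum_inv_filter_le {y X : ℝ} (hX : 0 ≤ X) (s : Finset ℕ) :
    ∑ n ∈ s.filter (fun n : ℕ => 1 ≤ y / (n : ℝ) ∧ y / (n : ℝ) ≤ X), (n : ℝ)⁻¹ ≤ X := by
  rcases le_or_gt y 0 with hy | hy
  · rw [Finset.sum_eq_zero]
    · exact hX
    · intro n hn
      have h1 := (Finset.mem_filter.1 hn).2.1
      have : y / (n : ℝ) ≤ 0 := div_nonpos_of_nonpos_of_nonneg hy (by positivity)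
      linarith
  have hpos : ∀ n : ℕ, 1 ≤ y / (n : ℝ) → (0 : ℝ) < n := by
    intro n hn
    rcases Nat.eq_zero_or_pos n with rfl | h
    · norm_num at hn
    · exact_mod_cast h
  calc _ ≤ ∑ n ∈ s.filter (fun n : ℕ => 1 ≤ y / (n : ℝ) ∧ y / (n : ℝ) ≤ X), X / y := by
        refine Finset.sum_le_sum fun n hn => ?_
        obtain ⟨h1, h2⟩ := (Finset.mem_filter.1 hn).2
        have hn0 := hpos n h1
        rw [div_le_iff₀ hn0] at h2
        rw [le_div_iff₀ hy, inv_mul_le_iff₀ hn0]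
        linarith
    _ ≤ ∑ n ∈ Finset.Icc 1 ⌊y⌋₊, X / y := by
        refine Finset.sum_le_sum_of_subset_of_nonneg (fun n hn => ?_)
          fun _ _ _ => by positivity
        obtain ⟨h1, h2⟩ := (Finset.mem_filter.1 hn).2
        have hn0 := hpos n h1
        rw [le_div_iff₀ hn0, one_mul] at h1
        rw [Finset.mem_Icc]
        exact ⟨by exact_mod_cast hn0, Nat.le_floor h1⟩
    _ = ⌊y⌋₊ * (X / y) := by simp
    _ ≤ y * (X / y) := by
        gcongr; exact Nat.floor_le hy.le
    _ = X := by field_simp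

/-- M vanishes below 1 and is near its limit for large x, so only a bounded window needs a separate
constant. -/
theorem exists_moebiusLogSum_sq_le (W : ℕ) [NeZero W] {η : ℝ} (hη : 0 < η) :
    ∃ X K : ℝ, 0 ≤ X ∧ 0 ≤ K ∧ ∀ x : ℝ, moebiusLogSum W x ^ 2 ≤
      (1 + η) * ((W : ℝ) / W.totient) ^ 2 + if 1 ≤ x ∧ x ≤ X then K else 0 := by
  have hW : (0 : ℝ) < W := by exact_mod_cast NeZero.pos W
  have hφ : (0 : ℝ) < W.totient := by exact_mod_cast Nat.totient_pos.2 (NeZero.pos W)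
  set c : ℝ := (W : ℝ) / W.totient
  have hc : 0 < c := by positivity
  have hlim := (tendsto_moebiusLogSum W).pow 2
  have hev := hlim.eventually_lt_const (show c ^ 2 < (1 + η) * c ^ 2 by nlinarith [pow_pos hc 2])
  obtain ⟨X, hX⟩ := eventually_atTop.1 hev
  refine ⟨max X 1, (2 * Real.log (max X 1)) ^ 2, by positivity, by positivity, fun x => ?_⟩
  have hpos : 0 ≤ (1 + η) * c ^ 2 := by positivity
  rcases lt_or_ge x 1 with hx | hx
  · rw [moebiusLogSum_of_lt_one W hx]
    have : (0 : ℝ) ≤ (2 * Real.log (max X 1)) ^ 2 := by positivity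
    split_ifs <;> simp only [ne_eq, OfNat.ofNat_ne_zero, not_false_eq_true, zero_pow, add_zero] <;>
      linarith
  rcases le_or_gt x (max X 1) with hx' | hx'
  · rw [if_pos ⟨hx, hx'⟩]
    have h1 := abs_moebiusLogSum_le_log W hx
    have h2 : |moebiusLogSum W x| ≤ 2 * Real.log (max X 1) := h1.trans (by gcongr)
    have h3 := pow_le_pow_left₀ (abs_nonneg _) h2 2
    rw [sq_abs] at h3
    linarith
  · rw [if_neg (fun h => absurd h.2 (not_le.2 hx')), add_zero]
    exact (hX x ((le_max_left _ _).trans hx'.le)).le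

/-- The inequality 2|xy| ≤ x² + y² reduces to a = b. The limiting value of M² multiplies ∑ 1/n,
while the window where M is not near its limit costs O(1). Uniformity in all a, b is essential: this
becomes a sup-norm bound. -/
theorem eventually_abs_pairSum_le (W : ℕ) [NeZero W] {η : ℝ} (hη : 0 < η) :
    ∀ᶠ R : ℝ in atTop, ∀ a b : ℕ,
      |pairSum W R a b| ≤ (1 + η) * ((W : ℝ) / W.totient * Real.log R) := by
  have hW : (0 : ℝ) < W := by exact_mod_cast NeZero.pos W
  have hφ : (0 : ℝ) < W.totient := by exact_mod_cast Nat.totient_pos.2 (NeZero.pos W)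
  set c : ℝ := (W : ℝ) / W.totient with hc_def
  obtain ⟨X, K, hX, hK, hM⟩ := exists_moebiusLogSum_sq_le W (half_pos hη)
  set A : ℝ := (1 + η / 2) * c ^ 2 with hA
  have hdiag : ∀ R : ℝ, 1 ≤ R → ∀ a : ℕ, pairSum W R a a ≤
      A * (W + (W.totient : ℝ) / W * (1 + Real.log R)) + K * X := by
    intro R hR a
    have hpt : ∀ n : ℕ, coprimeInd W n / n *
        (moebiusLogSum W (R / ((a * n : ℕ) : ℝ)) * moebiusLogSum W (R / ((a * n : ℕ) : ℝ))) ≤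
        A * (coprimeInd W n / n) +
          K * (if 1 ≤ R / a / (n : ℝ) ∧ R / a / (n : ℝ) ≤ X then (n : ℝ)⁻¹ else 0) := by
      intro n
      have h1 := hM (R / ((a * n : ℕ) : ℝ))
      rw [← sq]
      have h2 : R / ((a * n : ℕ) : ℝ) = R / a / n := by push_cast; rw [div_div]
      rw [h2] at h1 ⊢
      have h3 : 0 ≤ coprimeInd W n / n := div_nonneg (coprimeInd_nonneg W n) (by positivity)
      have h4 : coprimeInd W n / n ≤ (n : ℝ)⁻¹ := by
        rw [div_eq_mul_inv]
        exact mul_le_of_le_one_left (by positivity) (coprimeInd_le_one W n)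
      calc _ ≤ coprimeInd W n / n * (A + if 1 ≤ R / a / (n : ℝ) ∧ R / a / (n : ℝ) ≤ X
            then K else 0) := mul_le_mul_of_nonneg_left h1 h3
        _ ≤ _ := by
          split_ifs with h
          · nlinarith
          · simp [mul_comm]
    calc pairSum W R a a ≤ ∑ n ∈ Finset.Icc 1 ⌊R⌋₊, (A * (coprimeInd W n / n) +
          K * (if 1 ≤ R / a / (n : ℝ) ∧ R / a / (n : ℝ) ≤ X then (n : ℝ)⁻¹ else 0)) :=
          Finset.sum_le_sum fun n _ => hpt n
      _ = A * ∑ n ∈ Finset.Icc 1 ⌊R⌋₊, coprimeInd W n / n +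
          K * ∑ n ∈ (Finset.Icc 1 ⌊R⌋₊).filter
            (fun n : ℕ => 1 ≤ R / a / (n : ℝ) ∧ R / a / (n : ℝ) ≤ X),
            (n : ℝ)⁻¹ := by
          rw [Finset.sum_add_distrib, Finset.mul_sum, Finset.mul_sum,
            Finset.sum_filter]
          simp only [mul_ite, mul_zero]
      _ ≤ _ := by
          gcongr
          · exact sum_coprimeInd_div_le W hR
          · exact sum_inv_filter_le hX _
  have hnonneg : ∀ R : ℝ, ∀ a b : ℕ,
      |pairSum W R a b| ≤ (pairSum W R a a + pairSum W R b b) / 2 := by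
    intro R a b
    rw [pairSum, pairSum, pairSum, ← Finset.sum_add_distrib, Finset.sum_div]
    refine (Finset.abs_sum_le_sum_abs _ _).trans (Finset.sum_le_sum fun n _ => ?_)
    have h3 : 0 ≤ coprimeInd W n / n := div_nonneg (coprimeInd_nonneg W n) (by positivity)
    rw [abs_mul, abs_of_nonneg h3, ← mul_add, mul_div_assoc]
    refine mul_le_mul_of_nonneg_left ?_ h3
    rw [abs_le]
    constructor
    · nlinarith [sq_nonneg (moebiusLogSum W (R / ((a * n : ℕ) : ℝ)) +
        moebiusLogSum W (R / ((b * n : ℕ) : ℝ)))]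
    · nlinarith [sq_nonneg (moebiusLogSum W (R / ((a * n : ℕ) : ℝ)) -
        moebiusLogSum W (R / ((b * n : ℕ) : ℝ)))]
  have hlarge : ∀ᶠ R : ℝ in atTop,
      A * W + A * ((W.totient : ℝ) / W) + K * X ≤ η / 2 * c * Real.log R :=
    (Real.tendsto_log_atTop.const_mul_atTop (by positivity)).eventually_ge_atTop _
  filter_upwards [hlarge, eventually_ge_atTop 1] with R hR hR1 a b
  have hAc : A * ((W.totient : ℝ) / W) = (1 + η / 2) * c := by
    rw [hA, hc_def]; field_simp
  have hbound : A * (W + (W.totient : ℝ) / W * (1 + Real.log R)) + K * X ≤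
      (1 + η) * (c * Real.log R) := by
    calc _ = (A * W + A * ((W.totient : ℝ) / W) + K * X) +
          A * ((W.totient : ℝ) / W) * Real.log R := by ring
      _ ≤ η / 2 * c * Real.log R + (1 + η / 2) * c * Real.log R := by
          rw [hAc] at hR ⊢
          linarith
      _ = _ := by ring
  have h1 := hdiag R hR1 a
  have h2 := hdiag R hR1 b
  linarith [hnonneg R a b]

end GoldstonYildirim
end

/-! ### Dilation operators and multiplicative norm comparison -/

noncomputable section
namespace GoldstonYildirim

open BoundedContinuousFunction

section SeminormedRing

variable {A : Type*} [SeminormedCommRing A] {κ : Type*}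

theorem norm_prod_one_sub_le (h1 : ‖(1 : A)‖ ≤ 1) {x : κ → A} (s : Finset κ)
    (hx : ∀ i ∈ s, ‖x i‖ ≤ 1) : ‖∏ i ∈ s, (1 - x i)‖ ≤ 2 ^ s.card := by
  classical
  induction s using Finset.induction_on with
  | empty => simpa using h1
  | insert a s ha ih =>
    rw [Finset.prod_insert ha, Finset.card_insert_of_notMem ha, pow_succ']
    refine (norm_mul_le _ _).trans (mul_le_mul ?_ (ih fun i hi => hx i (Finset.mem_insert_of_mem hi))
      (norm_nonneg _) zero_le_two)
    exact (norm_sub_le _ _).trans (by linarith [hx a (Finset.mem_insert_self a s)])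

theorem norm_prod_one_sub_sub_one_le (h1 : ‖(1 : A)‖ ≤ 1) {x : κ → A} {ε : ℝ} (hε : 0 ≤ ε)
    (hε1 : ε ≤ 1) (s : Finset κ) (hx : ∀ i ∈ s, ‖x i‖ ≤ ε) :
    ‖∏ i ∈ s, (1 - x i) - 1‖ ≤ 2 ^ s.card * ε := by
  classical
  induction s using Finset.induction_on with
  | empty => simpa using hε
  | insert a s ha ih =>
    have hs : ∀ i ∈ s, ‖x i‖ ≤ ε := fun i hi => hx i (Finset.mem_insert_of_mem hi)
    have h2 := norm_prod_one_sub_le h1 s fun i hi => (hs i hi).trans hε1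
    have h3 : ‖x a * ∏ i ∈ s, (1 - x i)‖ ≤ ε * 2 ^ s.card :=
      (norm_mul_le _ _).trans (mul_le_mul (hx a (Finset.mem_insert_self a s)) h2
        (norm_nonneg _) hε)
    rw [Finset.prod_insert ha, Finset.card_insert_of_notMem ha]
    calc _ = ‖(∏ i ∈ s, (1 - x i) - 1) - x a * ∏ i ∈ s, (1 - x i)‖ := by congr 1; ring
      _ ≤ _ := norm_sub_le _ _
      _ ≤ 2 ^ s.card * ε + ε * 2 ^ s.card := add_le_add (ih hs) h3
      _ = _ := by ring

theorem norm_prod_one_sub_sub_le (h1 : ‖(1 : A)‖ ≤ 1) {x : κ → A} {ε : ℝ} (hε : 0 ≤ ε)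
    (hε1 : ε ≤ 1) (s : Finset κ) (hx : ∀ i ∈ s, ‖x i‖ ≤ ε) :
    ‖∏ i ∈ s, (1 - x i) - (1 - ∑ i ∈ s, x i)‖ ≤ 2 ^ s.card * s.card * ε ^ 2 := by
  classical
  induction s using Finset.induction_on with
  | empty => simp
  | insert a s ha ih =>
    have hs : ∀ i ∈ s, ‖x i‖ ≤ ε := fun i hi => hx i (Finset.mem_insert_of_mem hi)
    have h3 : ‖x a * (∏ i ∈ s, (1 - x i) - 1)‖ ≤ ε * (2 ^ s.card * ε) :=
      (norm_mul_le _ _).trans (mul_le_mul (hx a (Finset.mem_insert_self a s))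
        (norm_prod_one_sub_sub_one_le h1 hε hε1 s hs) (norm_nonneg _) hε)
    rw [Finset.prod_insert ha, Finset.sum_insert ha, Finset.card_insert_of_notMem ha]
    calc _ = ‖(∏ i ∈ s, (1 - x i) - (1 - ∑ i ∈ s, x i)) -
          x a * (∏ i ∈ s, (1 - x i) - 1)‖ := by congr 1; ring
      _ ≤ _ := norm_sub_le _ _
      _ ≤ 2 ^ s.card * s.card * ε ^ 2 + ε * (2 ^ s.card * ε) := add_le_add (ih hs) h3
      _ ≤ _ := by
        push_cast
        have : (0 : ℝ) ≤ 2 ^ s.card * s.card * ε ^ 2 := by positivity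
        have h5 : (0 : ℝ) ≤ 2 ^ s.card * ε ^ 2 := by positivity
        rw [pow_succ (2 : ℝ)]
        nlinarith

/-- The constant in the comparison of the local factors with those of the zeta function. -/
def localConst (n : ℕ) : ℝ :=
  3 * n ^ 2 + (1 + 3 * n) * (2 ^ n * n) + 4 ^ n * (2 * n) + n * (4 ^ n + 1) * 2 ^ n + 2 ^ n + 4 ^ n

theorem localConst_pos (n : ℕ) : 0 < localConst n := by unfold localConst; positivity

variable [Fintype κ]

/-- Writing X = ∑ x_j and Y = ∑ y_i, one has (1 - X + Y)(1 - Y) = 1 - X + XY - Y²: the first-order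
terms in Y cancel, leaving agreement with ∏(1 - x_j) to first order. -/
theorem norm_local_factor_sub_le_sq (h1 : ‖(1 : A)‖ ≤ 1) {x : κ × Bool → A} {y : κ → A} {ε : ℝ}
    (hε : 0 ≤ ε) (hε1 : ε ≤ 1) (hx : ∀ j, ‖x j‖ ≤ ε) (hy : ∀ i, ‖y i‖ ≤ ε) :
    ‖(1 - ∑ j, x j + ∑ i, y i) * ∏ i, (1 - y i) - ∏ j, (1 - x j)‖ ≤
      localConst (Fintype.card κ) * ε ^ 2 := by
  set n := Fintype.card κ with hn
  have hcard : (Finset.univ : Finset (κ × Bool)).card = 2 * n := by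
    rw [Finset.card_univ, Fintype.card_prod, Fintype.card_bool, mul_comm]
  have hX : ‖∑ j, x j‖ ≤ 2 * n * ε := by
    refine (norm_sum_le_of_le _ fun j _ => hx j).trans_eq ?_
    rw [Finset.sum_const, hcard, nsmul_eq_mul]; push_cast; ring
  have hY : ‖∑ i, y i‖ ≤ n * ε := by
    refine (norm_sum_le_of_le _ fun j _ => hy j).trans_eq ?_
    rw [Finset.sum_const, Finset.card_univ, nsmul_eq_mul]
  have hrD := norm_prod_one_sub_sub_le h1 hε hε1 Finset.univ fun i _ => hy i
  have hrN := norm_prod_one_sub_sub_le h1 hε hε1 Finset.univ fun j _ => hx j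
  rw [hcard] at hrN
  rw [Finset.card_univ, ← hn] at hrD
  set X := ∑ j, x j
  set Y := ∑ i, y i
  set D := ∏ i, (1 - y i)
  set N := ∏ j, (1 - x j)
  have hA : ‖1 - X + Y‖ ≤ 1 + 3 * n := by
    calc ‖1 - X + Y‖ ≤ ‖(1 : A)‖ + ‖X‖ + ‖Y‖ :=
          (norm_add_le _ _).trans (by gcongr; exact norm_sub_le _ _)
      _ ≤ 1 + 2 * n * ε + n * ε := by gcongr
      _ ≤ _ := by nlinarith
  calc _ = ‖X * Y - Y * Y + (1 - X + Y) * (D - (1 - Y)) - (N - (1 - X))‖ := by congr 1; ring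
    _ ≤ ‖X‖ * ‖Y‖ + ‖Y‖ * ‖Y‖ + ‖1 - X + Y‖ * ‖D - (1 - Y)‖ + ‖N - (1 - X)‖ := by
        refine (norm_sub_le _ _).trans ?_
        gcongr
        refine (norm_add_le _ _).trans ?_
        gcongr
        · refine (norm_sub_le _ _).trans ?_
          gcongr <;> exact norm_mul_le _ _
        · exact norm_mul_le _ _
    _ ≤ (2 * n * ε) * (n * ε) + (n * ε) * (n * ε) + (1 + 3 * n) * (2 ^ n * n * ε ^ 2) +
        2 ^ (2 * n) * ((2 * n : ℕ) : ℝ) * ε ^ 2 := by gcongr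
    _ ≤ _ := by
        -- These summands of `localConst` serve the first-order comparison below and are discarded
        -- here.
        have : (0 : ℝ) ≤ (n * (4 ^ n + 1) * 2 ^ n + 2 ^ n + 4 ^ n) * ε ^ 2 := by positivity
        rw [localConst, pow_mul]
        push_cast
        norm_num
        nlinarith

/-- No cancellation is used: a and both products are each within O(ε) of 1. -/
theorem norm_local_factor_sub_le (h1 : ‖(1 : A)‖ ≤ 1) {a : A} {x : κ × Bool → A} {y : κ → A}
    {ε : ℝ} (hε : 0 ≤ ε) (hε1 : ε ≤ 1) (hx : ∀ j, ‖x j‖ ≤ ε) (hy : ∀ i, ‖y i‖ ≤ ε)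
    (ha : ‖a - 1‖ ≤ Fintype.card κ * (4 ^ Fintype.card κ + 1) * ε) :
    ‖a * ∏ i, (1 - y i) - ∏ j, (1 - x j)‖ ≤ localConst (Fintype.card κ) * ε := by
  have hcard : (Finset.univ : Finset (κ × Bool)).card = 2 * Fintype.card κ := by
    rw [Finset.card_univ, Fintype.card_prod, Fintype.card_bool, mul_comm]
  have hD := norm_prod_one_sub_sub_one_le h1 hε hε1 Finset.univ fun i _ => hy i
  have hD2 := norm_prod_one_sub_le h1 Finset.univ fun i _ => (hy i).trans hε1
  have hN := norm_prod_one_sub_sub_one_le h1 hε hε1 Finset.univ fun j _ => hx j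
  rw [hcard] at hN
  rw [Finset.card_univ] at hD hD2
  set n := Fintype.card κ with hn
  set D := ∏ i, (1 - y i)
  set N := ∏ j, (1 - x j)
  calc _ = ‖(a - 1) * D + (D - 1) - (N - 1)‖ := by congr 1; ring
    _ ≤ ‖a - 1‖ * ‖D‖ + ‖D - 1‖ + ‖N - 1‖ := by
        refine (norm_sub_le _ _).trans ?_
        gcongr
        refine (norm_add_le _ _).trans ?_
        gcongr
        exact norm_mul_le _ _
    _ ≤ (n * (4 ^ n + 1) * ε) * 2 ^ n + 2 ^ n * ε + 2 ^ (2 * n) * ε := by gcongr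
    _ ≤ _ := by
        have : (0 : ℝ) ≤ (3 * n ^ 2 + (1 + 3 * n) * (2 ^ n * n) + 4 ^ n * (2 * n)) * ε := by
          positivity
        rw [localConst, pow_mul]
        norm_num
        nlinarith

end SeminormedRing

section Translation

variable {ι : Type*}

/-- Translation of bounded functions on the multiplicative monoid `ι → ℕ`. -/
def translate : (ι → ℕ) →* (((ι → ℕ) →ᵇ ℝ) →L[ℝ] ((ι → ℕ) →ᵇ ℝ)) where
  toFun v := compContinuousCLM (β := ℝ) (𝕜 := ℝ) ⟨fun a => a * v, by fun_prop⟩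
  map_one' := by ext f a; simp [compContinuousCLM]
  map_mul' v w := by
    ext f a
    change f (a * (v * w)) = f (a * v * w)
    rw [mul_assoc]

/-- The action of the monoid algebra of `ι → ℕ` on bounded functions by translations. -/
def act : MonoidAlgebra ℝ (ι → ℕ) →ₐ[ℝ] (((ι → ℕ) →ᵇ ℝ) →L[ℝ] ((ι → ℕ) →ᵇ ℝ)) :=
  MonoidAlgebra.lift ℝ _ (ι → ℕ) translate

theorem act_single (v : ι → ℕ) (c : ℝ) : act (MonoidAlgebra.single v c) = c • translate v :=
  MonoidAlgebra.lift_single _ _ _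

theorem act_single_apply (v : ι → ℕ) (c : ℝ) (f : (ι → ℕ) →ᵇ ℝ) (a : ι → ℕ) :
    act (MonoidAlgebra.single v c) f a = c * f (a * v) := by
  rw [act_single]; rfl

theorem act_sum_single_apply {α : Type*} (s : Finset α) (v : α → ι → ℕ) (c : α → ℝ)
    (f : (ι → ℕ) →ᵇ ℝ) (a : ι → ℕ) :
    act (∑ k ∈ s, MonoidAlgebra.single (v k) (c k)) f a = ∑ k ∈ s, c k * f (a * v k) := by
  rw [map_sum, _root_.sum_apply, coe_sum, Finset.sum_apply]
  exact Finset.sum_congr rfl fun k _ => act_single_apply _ _ _ _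

theorem act_mul_apply (x y : MonoidAlgebra ℝ (ι → ℕ)) (f : (ι → ℕ) →ᵇ ℝ) :
    act (x * y) f = act x (act y f) := by rw [map_mul]; rfl

theorem norm_act_one_le : ‖act (1 : MonoidAlgebra ℝ (ι → ℕ))‖ ≤ 1 := by
  rw [map_one]; exact ContinuousLinearMap.norm_id_le

theorem norm_act_single_le (v : ι → ℕ) (c : ℝ) : ‖act (MonoidAlgebra.single v c)‖ ≤ |c| := by
  rw [act_single]
  refine ContinuousLinearMap.opNorm_le_bound _ (abs_nonneg c) fun f => ?_
  rw [norm_le (mul_nonneg (abs_nonneg c) (norm_nonneg f))]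
  intro a
  change ‖c * f (a * v)‖ ≤ _
  rw [norm_mul, Real.norm_eq_abs c]
  exact mul_le_mul_of_nonneg_left (norm_coe_le_norm f _) (abs_nonneg c)

/-- The operator seminorm on the monoid algebra. -/
abbrev actSeminorm (ι : Type*) : SeminormedCommRing (MonoidAlgebra ℝ (ι → ℕ)) :=
  SeminormedCommRing.induced _ _ (act (ι := ι))

/-- By the reverse triangle inequality each 1 - x_i shrinks norms by at most a factor 2, so no
inverse operator has to be constructed. -/
theorem norm_le_norm_act_prod_one_sub {κ : Type*} {x : κ → MonoidAlgebra ℝ (ι → ℕ)}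
    (s : Finset κ) (hx : ∀ i ∈ s, ‖act (x i)‖ ≤ 1 / 2) (f : (ι → ℕ) →ᵇ ℝ) :
    ‖f‖ ≤ 2 ^ s.card * ‖act (∏ i ∈ s, (1 - x i)) f‖ := by
  classical
  induction s using Finset.induction_on with
  | empty => simp
  | insert a s ha ih =>
    rw [Finset.prod_insert ha, Finset.card_insert_of_notMem ha, act_mul_apply, pow_succ, mul_assoc]
    refine (ih fun i hi => hx i (Finset.mem_insert_of_mem hi)).trans ?_
    gcongr
    set g := act (∏ i ∈ s, (1 - x i)) f
    have h1 : ‖act (x a) g‖ ≤ 1 / 2 * ‖g‖ :=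
      ContinuousLinearMap.le_of_opNorm_le _ (hx a (Finset.mem_insert_self a s)) g
    have h2 : act (1 - x a) g = g - act (x a) g := by
      rw [map_sub, map_one]; rfl
    rw [h2]
    linarith [norm_sub_norm_le g (act (x a) g)]

/-- If the factors act boundedly on each other, so do the products. -/
theorem norm_act_prod_le {κ : Type*} {x y : κ → MonoidAlgebra ℝ (ι → ℕ)} {c : κ → ℝ}
    (s : Finset κ) (hc : ∀ i ∈ s, 0 ≤ c i)
    (h : ∀ i ∈ s, ∀ f, ‖act (x i) f‖ ≤ c i * ‖act (y i) f‖) (f : (ι → ℕ) →ᵇ ℝ) :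
    ‖act (∏ i ∈ s, x i) f‖ ≤ (∏ i ∈ s, c i) * ‖act (∏ i ∈ s, y i) f‖ := by
  classical
  induction s using Finset.induction_on generalizing f with
  | empty => simp
  | insert a s ha ih =>
    rw [Finset.prod_insert ha, Finset.prod_insert ha, Finset.prod_insert ha, mul_assoc]
    have hca := hc a (Finset.mem_insert_self a s)
    calc ‖act (x a * ∏ i ∈ s, x i) f‖ = ‖act (x a) (act (∏ i ∈ s, x i) f)‖ := by
          rw [act_mul_apply]
      _ ≤ c a * ‖act (y a) (act (∏ i ∈ s, x i) f)‖ := h a (Finset.mem_insert_self a s) _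
      -- Commutativity moves y a inside, and the induction hypothesis is used for the function act
      -- (y a) f; hence the induction generalizes f.
      _ = c a * ‖act (∏ i ∈ s, x i) (act (y a) f)‖ := by
          rw [← act_mul_apply, mul_comm (y a), act_mul_apply]
      _ ≤ c a * ((∏ i ∈ s, c i) * ‖act (∏ i ∈ s, y i) (act (y a) f)‖) := by
          gcongr
          exact ih (fun i hi => hc i (Finset.mem_insert_of_mem hi))
            (fun i hi => h i (Finset.mem_insert_of_mem hi)) _
      _ = _ := by rw [← act_mul_apply, mul_comm (∏ i ∈ s, y i)]

/-- The additive error δ ‖f‖ becomes relative, because b is bounded below. Relative errors are what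
can be multiplied over the primes. -/
theorem norm_act_le_of_sub_le {κ : Type*} [Fintype κ] {a b : MonoidAlgebra ℝ (ι → ℕ)}
    {x : κ → MonoidAlgebra ℝ (ι → ℕ)} (hb : b = ∏ j, (1 - x j))
    (hx : ∀ j, ‖act (x j)‖ ≤ 1 / 2) {δ : ℝ} (hab : ‖act (a - b)‖ ≤ δ) (f : (ι → ℕ) →ᵇ ℝ) :
    ‖act a f‖ ≤ (1 + 2 ^ Fintype.card κ * δ) * ‖act b f‖ := by
  have h1 := norm_le_norm_act_prod_one_sub Finset.univ (fun j _ => hx j) f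
  rw [← hb, Finset.card_univ] at h1
  have h2 := ContinuousLinearMap.le_of_opNorm_le _ hab f
  have h3 : act a f = act b f + act (a - b) f := by
    rw [map_sub]; simp
  have hδ : 0 ≤ δ := (norm_nonneg (act (a - b))).trans hab
  rw [h3]
  calc _ ≤ ‖act b f‖ + δ * ‖f‖ := (norm_add_le _ _).trans (by gcongr)
    _ ≤ ‖act b f‖ + δ * (2 ^ Fintype.card κ * ‖act b f‖) := by gcongr
    _ = _ := by ring

/-- Action of a product of elements each of which only affects one of the factors of a product. -/
theorem act_prod_apply_of_separated {κ α : Type*} [DecidableEq κ] {s : Finset κ} {S : κ → Finset α}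
    {v : κ → α → ι → ℕ} {c : κ → α → ℝ} {u w : κ → (ι → ℕ) → ℝ}
    (hu : ∀ i j k a, i ≠ j → u j (a * v i k) = u j a)
    (hw : ∀ i j k a, i ≠ j → w j (a * v i k) = w j a)
    (huw : ∀ i a, ∑ k ∈ S i, c i k * u i (a * v i k) = w i a)
    {f : (ι → ℕ) →ᵇ ℝ} (hf : ∀ a, f a = ∏ i ∈ s, u i a) (a : ι → ℕ) :
    act (∏ i ∈ s, ∑ k ∈ S i, MonoidAlgebra.single (v i k) (c i k)) f a = ∏ i ∈ s, w i a := by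
  -- Partial application: the factors in t have been transformed to w, the others are still u.
  have key : ∀ t ⊆ s, ∀ a, act (∏ i ∈ t, ∑ k ∈ S i, MonoidAlgebra.single (v i k) (c i k)) f a =
      (∏ i ∈ t, w i a) * ∏ i ∈ s \ t, u i a := by
    intro t
    induction t using Finset.induction_on with
    | empty => intro _ a; simp [hf]
    | insert i t hi ih =>
      intro hts a
      have hit : i ∈ s \ t := Finset.mem_sdiff.2 ⟨hts (Finset.mem_insert_self i t), hi⟩
      have ht : t ⊆ s := (Finset.subset_insert i t).trans hts
      rw [Finset.prod_insert hi, act_mul_apply, act_sum_single_apply, Finset.prod_insert hi,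
        ← huw, Finset.sum_mul, Finset.sum_mul]
      refine Finset.sum_congr rfl fun k _ => ?_
      rw [ih ht, ← Finset.mul_prod_erase _ _ hit, Finset.sdiff_insert]
      have e1 : ∏ j ∈ t, w j (a * v i k) = ∏ j ∈ t, w j a :=
        Finset.prod_congr rfl fun j hj => hw i j k a fun h => hi (h ▸ hj)
      have e2 : ∏ j ∈ (s \ t).erase i, u j (a * v i k) = ∏ j ∈ (s \ t).erase i, u j a :=
        Finset.prod_congr rfl fun j hj => hu i j k a (Finset.ne_of_mem_erase hj).symm
      rw [e1, e2]
      ring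
  simpa using key s subset_rfl a

end Translation

end GoldstonYildirim
end

/-! ### Euler products acting on the logarithmic weight -/

noncomputable section
namespace GoldstonYildirim

open BoundedContinuousFunction ArithmeticFunction
open scoped ArithmeticFunction.Moebius

/-- The primes up to `N` not dividing `W`. -/
def sievePrimes (W N : ℕ) : Finset ℕ := (Finset.Icc 1 N).filter fun p => p.Prime ∧ ¬ p ∣ W

theorem mem_sievePrimes {W N p : ℕ} : p ∈ sievePrimes W N ↔ p ≤ N ∧ p.Prime ∧ ¬ p ∣ W := by
  simp only [sievePrimes, Finset.mem_filter, Finset.mem_Icc]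
  constructor
  · rintro ⟨⟨-, h⟩, h'⟩; exact ⟨h, h'⟩
  · rintro ⟨h, h'⟩; exact ⟨⟨h'.1.one_le, h⟩, h'⟩

theorem prime_of_mem_sievePrimes {W N p : ℕ} (hp : p ∈ sievePrimes W N) : p.Prime :=
  (mem_sievePrimes.1 hp).2.1

theorem prod_sievePrimes_ne_zero (W N : ℕ) : ∏ p ∈ sievePrimes W N, p ≠ 0 :=
  Finset.prod_ne_zero_iff.2 fun _ hp => (prime_of_mem_sievePrimes hp).ne_zero

theorem dvd_prod_sievePrimes {W N d : ℕ} (hd : Squarefree d) (hdN : d ≤ N)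
    (hW : d.Coprime W) : d ∣ ∏ p ∈ sievePrimes W N, p := by
  rw [← Nat.prod_primeFactors_of_squarefree hd]
  refine Finset.prod_dvd_prod_of_subset _ _ _ fun p hp => ?_
  have hp' := Nat.prime_of_mem_primeFactors hp
  have hpd := Nat.dvd_of_mem_primeFactors hp
  refine mem_sievePrimes.2 ⟨(Nat.le_of_dvd (Nat.pos_of_ne_zero hd.ne_zero) hpd).trans hdN, hp',
    fun h => ?_⟩
  exact hp'.one_lt.ne' (Nat.dvd_one.1 (hW ▸ Nat.dvd_gcd hpd h))

theorem coprime_prod_sievePrimes (W N : ℕ) : (∏ p ∈ sievePrimes W N, p).Coprime W :=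
  Nat.Coprime.prod_left fun _ hp =>
    ((prime_of_mem_sievePrimes hp).coprime_iff_not_dvd).2 (mem_sievePrimes.1 hp).2.2

/-- Both sides run over squarefree d ≤ N coprime to W: μ removes the other terms on the right, the
cutoff of F those on the left. This translates Euler products into truncated sums. -/
theorem sum_divisors_prod_sievePrimes (W N : ℕ) {F : ℕ → ℝ} (hF : ∀ d, N < d → F d = 0) :
    ∑ d ∈ (∏ p ∈ sievePrimes W N, p).divisors, (μ d : ℝ) * F d =
      ∑ d ∈ Finset.Icc 1 N, (μ d : ℝ) * (coprimeInd W d * F d) := by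
  have h1 : ∑ d ∈ (∏ p ∈ sievePrimes W N, p).divisors, (μ d : ℝ) * F d =
      ∑ d ∈ (∏ p ∈ sievePrimes W N, p).divisors ∩ Finset.Icc 1 N,
        (μ d : ℝ) * (coprimeInd W d * F d) := by
    rw [← Finset.sum_subset Finset.inter_subset_left]
    · refine Finset.sum_congr rfl fun d hd => ?_
      have hd1 := Nat.dvd_of_mem_divisors (Finset.mem_inter.1 hd).1
      rw [coprimeInd, if_pos (Nat.Coprime.coprime_dvd_left hd1 (coprime_prod_sievePrimes W N)),
        one_mul]
    · intro d hd hd'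
      rw [hF, mul_zero]
      by_contra hN
      exact hd' (Finset.mem_inter.2 ⟨hd, Finset.mem_Icc.2
        ⟨Nat.pos_of_mem_divisors hd, not_lt.1 hN⟩⟩)
  rw [h1]
  refine Finset.sum_subset Finset.inter_subset_right fun d hd hd' => ?_
  by_cases hsq : Squarefree d
  · by_cases hW : d.Coprime W
    · exact absurd (Finset.mem_inter.2 ⟨Nat.mem_divisors.2
        ⟨dvd_prod_sievePrimes hsq (Finset.mem_Icc.1 hd).2 hW, prod_sievePrimes_ne_zero W N⟩, hd⟩) hd'
    · simp [coprimeInd, hW]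
  · simp [moebius_eq_zero_of_not_squarefree hsq]

/-- Group by k = dn. The cutoff of H makes the truncated divisor sums complete, so Möbius inversion
is exact. -/
theorem sum_sum_moebius_mul {N : ℕ} (hN : 1 ≤ N) {H : ℕ → ℝ} (hH : ∀ k, N < k → H k = 0) :
    ∑ d ∈ Finset.Icc 1 N, ∑ n ∈ Finset.Icc 1 N, (μ d : ℝ) * H (d * n) = H 1 := by
  have h1 : ∀ d ∈ Finset.Icc 1 N, ∑ n ∈ Finset.Icc 1 N, (μ d : ℝ) * H (d * n) =
      ∑ k ∈ Finset.Icc 1 N, if d ∣ k then (μ d : ℝ) * H k else 0 := by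
    intro d hd
    have hd1 := (Finset.mem_Icc.1 hd).1
    rw [← Finset.sum_filter]
    symm
    calc ∑ k ∈ (Finset.Icc 1 N).filter (d ∣ ·), (μ d : ℝ) * H k
        = ∑ n ∈ (Finset.Icc 1 N).filter (fun n => d * n ≤ N), (μ d : ℝ) * H (d * n) := by
          refine Finset.sum_bij' (fun k _ => k / d) (fun n _ => d * n) ?_ ?_ ?_ ?_ ?_
          · intro k hk
            simp only [Finset.mem_filter, Finset.mem_Icc] at hk ⊢
            obtain ⟨⟨h1, h2⟩, h3⟩ := hk
            rw [Nat.mul_div_cancel' h3]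
            exact ⟨⟨Nat.div_pos (Nat.le_of_dvd h1 h3) hd1, (Nat.div_le_self _ _).trans h2⟩, h2⟩
          · intro n hn
            simp only [Finset.mem_filter, Finset.mem_Icc] at hn ⊢
            exact ⟨⟨Nat.mul_pos hd1 hn.1.1, hn.2⟩, dvd_mul_right _ _⟩
          · intro k hk
            exact Nat.mul_div_cancel' (Finset.mem_filter.1 hk).2
          · intro n _
            exact Nat.mul_div_cancel_left n hd1
          · intro k hk
            rw [Nat.mul_div_cancel' (Finset.mem_filter.1 hk).2]
      _ = _ := by
          refine Finset.sum_subset (Finset.filter_subset _ _) fun n hn hn' => ?_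
          rw [hH, mul_zero]
          by_contra h
          exact hn' (Finset.mem_filter.2 ⟨hn, not_lt.1 h⟩)
  rw [Finset.sum_congr rfl h1, Finset.sum_comm,
    Finset.sum_eq_single_of_mem 1 (Finset.mem_Icc.2 ⟨le_rfl, hN⟩)]
  · rw [Finset.sum_eq_single_of_mem 1 (Finset.mem_Icc.2 ⟨le_rfl, hN⟩)]
    · simp
    · intro d _ hd
      rw [if_neg fun h => hd (Nat.dvd_one.1 h)]
  · intro k hk hk1
    have hk' := Finset.mem_Icc.1 hk
    rw [← Finset.sum_filter, ← Finset.sum_mul]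
    have h2 : (Finset.Icc 1 N).filter (· ∣ k) = k.divisors := by
      ext d
      simp only [Finset.mem_filter, Finset.mem_Icc, Nat.mem_divisors]
      constructor
      · exact fun h => ⟨h.2, by omega⟩
      · exact fun h => ⟨⟨Nat.pos_of_dvd_of_pos h.1 (by omega),
          (Nat.le_of_dvd (by omega) h.1).trans hk'.2⟩, h.1⟩
    have h3 : ∑ d ∈ k.divisors, (μ d : ℤ) = 0 := by
      rw [← coe_mul_zeta_apply, moebius_mul_coe_zeta, one_apply_ne hk1]
    rw [h2, ← Int.cast_sum, h3]; simp

section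

variable {ι : Type*} [DecidableEq ι]

/-- The embedding of `ℕ` as a coordinate of `ι → ℕ`. -/
def coordHom (j : ι) : ℕ →* (ι → ℕ) := MonoidHom.mulSingle (fun _ => ℕ) j

theorem coordHom_apply_self (j : ι) (n : ℕ) : coordHom j n j = n := by
  simp [coordHom]

theorem coordHom_apply_of_ne {i j : ι} (h : i ≠ j) (n : ℕ) : coordHom i n j = 1 := by
  simp [coordHom, h.symm]

end

section

variable {ι : Type*}

theorem prod_one_sub_single (e : ℕ →* (ι → ℕ)) (b : ℕ → ℝ) {P : Finset ℕ}
    (hP : ∀ p ∈ P, p.Prime) :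
    ∏ p ∈ P, (1 - MonoidAlgebra.single (e p) (b p)) =
      ∑ d ∈ (∏ p ∈ P, p).divisors,
        MonoidAlgebra.single (e d) ((μ d : ℝ) * ∏ p ∈ d.primeFactors, b p) := by
  rw [prod_one_sub_eq_sum_divisors _ hP]
  refine Finset.sum_congr rfl fun d _ => ?_
  rw [MonoidAlgebra.prod_single, ← map_prod]
  by_cases hd : Squarefree d
  · rw [Nat.prod_primeFactors_of_squarefree hd, ← zsmul_eq_mul, MonoidAlgebra.smul_single,
      zsmul_eq_mul]
  · rw [moebius_eq_zero_of_not_squarefree hd]; simp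

theorem prod_primeFactors_inv {d : ℕ} (hd : Squarefree d) :
    ∏ p ∈ d.primeFactors, (p : ℝ)⁻¹ = (d : ℝ)⁻¹ := by
  rw [Finset.prod_inv_distrib, ← Nat.cast_prod, Nat.prod_primeFactors_of_squarefree hd]

theorem posLog_div_nat_le {R : ℝ} (hR : 0 ≤ R) (n : ℕ) : Real.posLog (R / n) ≤ Real.posLog R := by
  rcases Nat.eq_zero_or_pos n with rfl | hn
  · simp [Real.posLog_nonneg]
  · exact Real.posLog_le_posLog (by positivity) (div_le_self hR (by exact_mod_cast hn))

variable [Fintype ι]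

/-- The function `a ↦ ∏ log⁺ (R / a j)`. -/
def weightFn (R : ℝ) : (ι → ℕ) →ᵇ ℝ :=
  -- The absolute value makes boundedness hold for every real R. A zero coordinate gives
  -- `Real.posLog 0 = 0`.
  ofNormedAddCommGroupDiscrete (fun a => ∏ j, Real.posLog (|R| / a j))
    (∏ _j : ι, Real.posLog |R|) fun a => by
      rw [norm_prod]
      refine Finset.prod_le_prod (fun _ _ => norm_nonneg _) fun j _ => ?_
      rw [Real.norm_of_nonneg Real.posLog_nonneg]
      exact posLog_div_nat_le (abs_nonneg R) _

theorem weightFn_apply {R : ℝ} (hR : 0 ≤ R) (a : ι → ℕ) :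
    weightFn R a = ∏ j, Real.posLog (R / a j) := by
  conv_rhs => rw [← abs_of_nonneg hR]
  rfl

theorem weightFn_eq_zero {R : ℝ} (hR : 0 ≤ R) {a : ι → ℕ} {j : ι}
    (h : a j = 0 ∨ ⌊R⌋₊ < a j) : weightFn R a = 0 := by
  rw [weightFn_apply hR]
  refine Finset.prod_eq_zero (Finset.mem_univ j) ?_
  rcases h with h | h
  · simp [h]
  · exact posLog_div_eq_zero h hR

theorem sum_divisors_posLog (W : ℕ) {R : ℝ} (hR : 0 ≤ R) (a : ℕ) :
    ∑ d ∈ (∏ p ∈ sievePrimes W ⌊R⌋₊, p).divisors,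
      ((μ d : ℝ) * ∏ p ∈ d.primeFactors, (p : ℝ)⁻¹) * Real.posLog (R / ((a * d : ℕ) : ℝ)) =
      moebiusLogSum W (R / a) := by
  rcases Nat.eq_zero_or_pos a with rfl | ha
  · simp [moebiusLogSum_of_lt_one W (show (0 : ℝ) < 1 by norm_num)]
  have ha' : (1 : ℝ) ≤ a := by exact_mod_cast ha
  rw [moebiusLogSum_eq_of_le W (by positivity)
    (Nat.floor_le_floor (div_le_self hR ha') : _ ≤ ⌊R⌋₊)]
  have h1 := sum_divisors_prod_sievePrimes W ⌊R⌋₊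
    (F := fun d => (d : ℝ)⁻¹ * Real.posLog (R / ((a * d : ℕ) : ℝ))) fun d hd => by
      rw [posLog_div_eq_zero (hd.trans_le (Nat.le_mul_of_pos_left d ha)) hR, mul_zero]
  calc _ = _ := Finset.sum_congr rfl fun d _ => by
        rw [mul_assoc]
        exact moebius_mul_congr_of_squarefree
          (f := fun d => (∏ p ∈ d.primeFactors, (p : ℝ)⁻¹) * Real.posLog (R / ((a * d : ℕ) : ℝ)))
          (g := fun d => (d : ℝ)⁻¹ * Real.posLog (R / ((a * d : ℕ) : ℝ)))
          fun hd => by simp only [prod_primeFactors_inv hd]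
    _ = _ := h1
    _ = _ := Finset.sum_congr rfl fun d _ => by
        rw [coprimeMoebius, Nat.cast_mul, div_div]; ring

variable [DecidableEq ι]

/-- The numerators 1/ζ(1 + s_j) of the model: the Euler product in each coordinate expands into a
Möbius sum and turns log⁺ into M. -/
theorem act_prod_one_sub_inv_apply (W : ℕ) {R : ℝ} (hR : 0 ≤ R) (a : ι → ℕ) :
    act (∏ p ∈ sievePrimes W ⌊R⌋₊, ∏ j : ι,
      (1 - MonoidAlgebra.single (coordHom j p) (p : ℝ)⁻¹)) (weightFn R) a =
      ∏ j, moebiusLogSum W (R / a j) := by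
  rw [Finset.prod_comm]
  simp only [prod_one_sub_single _ _ fun p hp => prime_of_mem_sievePrimes hp]
  refine act_prod_apply_of_separated (u := fun j a => Real.posLog (R / a j))
    (w := fun j a => moebiusLogSum W (R / a j)) ?_ ?_ ?_ (weightFn_apply hR) a
  · intro i j k a hij
    simp [coordHom_apply_of_ne hij]
  · intro i j k a hij
    simp [coordHom_apply_of_ne hij]
  · intro j a
    simp only [Pi.mul_apply, coordHom_apply_self]
    exact sum_divisors_posLog W hR (a j)

end

section

variable {κ : Type*} [DecidableEq κ]

/-- The diagonal embedding of `ℕ` in a pair of coordinates. -/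
def pairHom (i : κ) : ℕ →* (κ × Bool → ℕ) := coordHom (i, false) * coordHom (i, true)

theorem pairHom_apply_self (i : κ) (b : Bool) (n : ℕ) : pairHom i n (i, b) = n := by
  cases b <;> simp [pairHom, coordHom_apply_self, coordHom_apply_of_ne]

theorem pairHom_apply_of_ne {i j : κ} (h : i ≠ j) (b : Bool) (n : ℕ) :
    pairHom i n (j, b) = 1 := by
  simp [pairHom, coordHom_apply_of_ne, h]

variable [Fintype κ]

/-- The sum `∑ n⁻¹ [n]` over `n ≤ R` coprime to `W`, in the `i`-th pair of coordinates. -/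
def pairElem (W : ℕ) (R : ℝ) (i : κ) : MonoidAlgebra ℝ (κ × Bool → ℕ) :=
  ∑ n ∈ Finset.Icc 1 ⌊R⌋₊, MonoidAlgebra.single (pairHom i n) (coprimeInd W n / n)

/-- By commutativity the coordinatewise Euler products can act first, giving a product of values of
M; the sums over n then dilate both members of each pair. -/
theorem act_pairElem_mul_apply (W : ℕ) {R : ℝ} (hR : 0 ≤ R) (a : κ × Bool → ℕ) :
    act (∏ p ∈ sievePrimes W ⌊R⌋₊, ∏ j : κ × Bool,
      (1 - MonoidAlgebra.single (coordHom j p) (p : ℝ)⁻¹)) (act (∏ i, pairElem W R i)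
        (weightFn R)) a = ∏ i, pairSum W R (a (i, false)) (a (i, true)) := by
  rw [← act_mul_apply, mul_comm, act_mul_apply]
  simp only [pairElem]
  refine act_prod_apply_of_separated
    (u := fun i a => moebiusLogSum W (R / a (i, false)) * moebiusLogSum W (R / a (i, true)))
    (w := fun i a => pairSum W R (a (i, false)) (a (i, true))) ?_ ?_ ?_ (fun a => ?_) a
  · intro i j k a hij
    simp [pairHom_apply_of_ne hij]
  · intro i j k a hij
    simp [pairHom_apply_of_ne hij]
  · intro i a
    simp only [Pi.mul_apply, pairHom_apply_self]
    rfl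
  · rw [act_prod_one_sub_inv_apply W hR, Fintype.prod_prod_type]
    refine Finset.prod_congr rfl fun i _ => ?_
    rw [Fintype.prod_bool, mul_comm]

theorem act_prod_eq_of_forall {α : Type*} (s : Finset α) {ι : Type*}
    {x : α → MonoidAlgebra ℝ (ι → ℕ)} {f : (ι → ℕ) →ᵇ ℝ} (h : ∀ i, act (x i) f = f) :
    act (∏ i ∈ s, x i) f = f := by
  classical
  induction s using Finset.induction_on with
  | empty => simp
  | insert a s ha ih => rw [Finset.prod_insert ha, act_mul_apply, ih, h]

/-- Möbius inversion along the i-th pair. The truncated sum `pairElem` inverts the Euler product on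
this weight because the weight vanishes once a coordinate exceeds R. -/
theorem act_inverse_apply (W : ℕ) {R : ℝ} (hR : 1 ≤ R) (i : κ) :
    act ((∏ p ∈ sievePrimes W ⌊R⌋₊, (1 - MonoidAlgebra.single (pairHom i p) (p : ℝ)⁻¹)) *
      pairElem W R i) (weightFn R) = weightFn R := by
  have hR0 : 0 ≤ R := by linarith
  ext a
  rw [prod_one_sub_single _ _ fun p hp => prime_of_mem_sievePrimes hp, act_mul_apply,
    act_sum_single_apply]
  set H : ℕ → ℝ := fun k => coprimeInd W k / k * weightFn R (a * pairHom i k) with hH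
  have hvanish : ∀ k n : ℕ, ⌊R⌋₊ < k → 1 ≤ n → weightFn R (a * pairHom i (k * n)) = 0 := by
    intro k n hk hn
    refine weightFn_eq_zero hR0 (j := (i, false)) ?_
    rw [Pi.mul_apply, pairHom_apply_self]
    rcases Nat.eq_zero_or_pos (a (i, false)) with h | h
    · left; simp [h]
    · right; exact hk.trans_le ((Nat.le_mul_of_pos_right k hn).trans (Nat.le_mul_of_pos_left _ h))
  have hinner : ∀ d, act (pairElem W R i) (weightFn R) (a * pairHom i d) =
      ∑ n ∈ Finset.Icc 1 ⌊R⌋₊, coprimeInd W n / n * weightFn R (a * pairHom i (d * n)) := by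
    intro d
    rw [pairElem, act_sum_single_apply]
    refine Finset.sum_congr rfl fun n _ => ?_
    rw [map_mul (pairHom i), mul_assoc a]
  have hsum := sum_divisors_prod_sievePrimes W ⌊R⌋₊
    (F := fun d => (d : ℝ)⁻¹ * ∑ n ∈ Finset.Icc 1 ⌊R⌋₊,
      coprimeInd W n / n * weightFn R (a * pairHom i (d * n))) fun d hd => by
      rw [Finset.sum_eq_zero, mul_zero]
      intro n hn
      rw [hvanish d n hd (Finset.mem_Icc.1 hn).1, mul_zero]
  calc _ = _ := Finset.sum_congr rfl fun d _ => by
        rw [mul_assoc, hinner]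
        exact moebius_mul_congr_of_squarefree
          (f := fun d => (∏ p ∈ d.primeFactors, (p : ℝ)⁻¹) * ∑ n ∈ Finset.Icc 1 ⌊R⌋₊,
            coprimeInd W n / n * weightFn R (a * pairHom i (d * n)))
          (g := fun d => (d : ℝ)⁻¹ * ∑ n ∈ Finset.Icc 1 ⌊R⌋₊,
            coprimeInd W n / n * weightFn R (a * pairHom i (d * n)))
          fun hd => by simp only [prod_primeFactors_inv hd]
    _ = _ := hsum
    _ = ∑ d ∈ Finset.Icc 1 ⌊R⌋₊, ∑ n ∈ Finset.Icc 1 ⌊R⌋₊, (μ d : ℝ) * H (d * n) := by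
        refine Finset.sum_congr rfl fun d _ => ?_
        rw [Finset.mul_sum, Finset.mul_sum, Finset.mul_sum]
        refine Finset.sum_congr rfl fun n _ => ?_
        simp only [hH, coprimeInd_mul, Nat.cast_mul, div_eq_mul_inv, mul_inv]
        ring
    _ = H 1 := by
        refine sum_sum_moebius_mul (Nat.le_floor (by simpa using hR)) fun k hk => ?_
        have := hvanish k 1 hk le_rfl
        rw [mul_one] at this
        simp only [hH, this, mul_zero]
    _ = _ := by simp [hH, coprimeInd]

theorem act_inverse_prod_apply (W : ℕ) {R : ℝ} (hR : 1 ≤ R) :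
    act (∏ p ∈ sievePrimes W ⌊R⌋₊, ∏ i : κ, (1 - MonoidAlgebra.single (pairHom i p) (p : ℝ)⁻¹))
      (act (∏ i : κ, pairElem W R i) (weightFn R)) = weightFn R := by
  rw [← act_mul_apply, Finset.prod_comm, ← Finset.prod_mul_distrib]
  exact act_prod_eq_of_forall _ fun i => act_inverse_apply W hR i

end

end GoldstonYildirim
end

/-! ### Local factors at a prime -/

noncomputable section
namespace GoldstonYildirim

open BoundedContinuousFunction

theorem prod_one_sub_eq_of_orthogonal {A κ : Type*} [CommRing A] (s : Finset κ) {z : κ → A}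
    (hz : ∀ i ∈ s, ∀ j ∈ s, i ≠ j → z i * z j = 0) :
    ∏ i ∈ s, (1 - z i) = 1 - ∑ i ∈ s, z i := by
  classical
  induction s using Finset.induction_on with
  | empty => simp
  | insert a s ha ih =>
    rw [Finset.prod_insert ha, Finset.sum_insert ha, ih fun i hi j hj =>
      hz i (Finset.mem_insert_of_mem hi) j (Finset.mem_insert_of_mem hj)]
    have h : z a * ∑ i ∈ s, z i = 0 := by
      rw [Finset.mul_sum]
      exact Finset.sum_eq_zero fun i hi => hz a (Finset.mem_insert_self a s) i
        (Finset.mem_insert_of_mem hi) fun h => ha (h ▸ hi)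
    linear_combination h

variable {κ : Type*}

/-- The indicator function of the condition `p ∣ W (t + h) + 1` on a residue class `t` mod `p`. -/
def rootInd (p W : ℕ) (h : ℤ) (t : ZMod p) : ℝ :=
  if (W : ZMod p) * (t + (h : ZMod p)) + 1 = 0 then 1 else 0

theorem rootInd_eq_zero_or_one (p W : ℕ) (h : ℤ) (t : ZMod p) :
    rootInd p W h t = 0 ∨ rootInd p W h t = 1 := by
  unfold rootInd; split_ifs <;> simp

theorem eq_root_iff {p W : ℕ} (hp : p.Prime) (hW : ¬ p ∣ W) (h : ℤ) (t : ZMod p) :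
    (W : ZMod p) * (t + (h : ZMod p)) + 1 = 0 ↔ t = -(W : ZMod p)⁻¹ - (h : ZMod p) := by
  have := Fact.mk hp
  have hW0 : (W : ZMod p) ≠ 0 := fun h' => hW ((ZMod.natCast_eq_zero_iff W p).1 h')
  constructor
  · intro h1
    have h2 : t + (h : ZMod p) = -(W : ZMod p)⁻¹ := by
      field_simp
      linear_combination h1
    linear_combination h2
  · rintro rfl
    field_simp
    ring

theorem sum_rootInd {p W : ℕ} [NeZero p] (hp : p.Prime) (hW : ¬ p ∣ W) (h : ℤ) :
    ∑ t : ZMod p, rootInd p W h t = 1 := by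
  simp only [rootInd, eq_root_iff hp hW]
  simp

theorem rootInd_mul_eq_zero {p W : ℕ} (hp : p.Prime) (hW : ¬ p ∣ W) {h h' : ℤ}
    (hne : (h : ZMod p) ≠ (h' : ZMod p)) (t : ZMod p) :
    rootInd p W h t * rootInd p W h' t = 0 := by
  simp only [rootInd, eq_root_iff hp hW]
  split_ifs with h1 h2
  · exact absurd (by linear_combination h1 - h2) hne
  all_goals simp

variable [DecidableEq κ]

theorem single_pairHom (i : κ) (n : ℕ) (r s : ℝ) :
    MonoidAlgebra.single (coordHom (i, false) n) r * MonoidAlgebra.single (coordHom (i, true) n) s =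
      MonoidAlgebra.single (pairHom i n) (r * s) := by
  rw [MonoidAlgebra.single_mul_single]; rfl

variable [Fintype κ]

/-- The factor at `p` of the sieve operator for the residue class `t` mod `p`. -/
def localElem (p W : ℕ) (h : κ → ℤ) (t : ZMod p) : MonoidAlgebra ℝ (κ × Bool → ℕ) :=
  ∏ j : κ × Bool, (1 - MonoidAlgebra.single (coordHom j p) (rootInd p W (h j.1) t))

/-- The average of the factor at `p` over all residue classes. -/
def avgElem (p W : ℕ) [NeZero p] (h : κ → ℤ) : MonoidAlgebra ℝ (κ × Bool → ℕ) :=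
  ∑ t : ZMod p, (p : ℝ)⁻¹ • localElem p W h t

/-- Since ρ = `rootInd` is 0 or 1, (1 - ρA)(1 - ρB) = 1 - ρ(A + B - AB). -/
theorem localElem_eq_prod (p W : ℕ) (h : κ → ℤ) (t : ZMod p) :
    localElem p W h t = ∏ i, (1 - rootInd p W (h i) t •
      (MonoidAlgebra.single (coordHom (i, false) p) 1 +
        MonoidAlgebra.single (coordHom (i, true) p) 1 -
        MonoidAlgebra.single (pairHom i p) 1)) := by
  rw [localElem, Fintype.prod_prod_type]
  refine Finset.prod_congr rfl fun i _ => ?_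
  rw [Fintype.prod_bool, ← mul_one (1 : ℝ), ← single_pairHom, mul_one]
  rcases rootInd_eq_zero_or_one p W (h i) t with h0 | h0 <;> simp only [h0]
  · simp
  · rw [one_smul]; ring

/-- Each i has exactly one root t mod p and distinct i have distinct roots, so all cross terms
vanish and averaging gives each surviving term weight 1/p. -/
theorem avgElem_eq_of_injective {p W : ℕ} [NeZero p] (hp : p.Prime) (hW : ¬ p ∣ W) {h : κ → ℤ}
    (hh : ∀ i j, i ≠ j → (h i : ZMod p) ≠ (h j : ZMod p)) :
    avgElem p W h = 1 - ∑ j : κ × Bool, MonoidAlgebra.single (coordHom j p) (p : ℝ)⁻¹ +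
      ∑ i, MonoidAlgebra.single (pairHom i p) (p : ℝ)⁻¹ := by
  have hp0 : (p : ℝ) ≠ 0 := by exact_mod_cast hp.ne_zero
  have hlocal : ∀ t : ZMod p, localElem p W h t = 1 - ∑ i, rootInd p W (h i) t •
      (MonoidAlgebra.single (coordHom (i, false) p) 1 +
        MonoidAlgebra.single (coordHom (i, true) p) 1 -
        MonoidAlgebra.single (pairHom i p) 1) := by
    intro t
    rw [localElem_eq_prod]
    refine prod_one_sub_eq_of_orthogonal _ fun i _ j _ hij => ?_
    rw [smul_mul_smul_comm, rootInd_mul_eq_zero hp hW (hh i j hij), zero_smul]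
  rw [avgElem, ← Finset.smul_sum]
  simp only [hlocal]
  rw [Finset.sum_sub_distrib, Finset.sum_comm]
  simp only [← Finset.sum_smul, sum_rootInd hp hW, one_smul]
  rw [Finset.sum_const, Finset.card_univ, ZMod.card, smul_sub, ← Nat.cast_smul_eq_nsmul ℝ,
    smul_smul, inv_mul_cancel₀ hp0, one_smul, Finset.sum_sub_distrib, Finset.sum_add_distrib,
    Fintype.sum_prod_type]
  simp only [Fintype.sum_bool, smul_sub, smul_add, Finset.smul_sum, MonoidAlgebra.smul_single,
    smul_eq_mul, mul_one, Finset.sum_add_distrib]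
  abel

/-- The local element is 1 unless t is one of at most |κ| roots, and there the trivial bound 4^|κ| +
1 suffices. The roots need not be distinct. -/
theorem norm_act_avgElem_sub_one_le {p W : ℕ} [NeZero p] (hp : p.Prime) (hW : ¬ p ∣ W)
    (h : κ → ℤ) : ‖act (avgElem p W h - 1)‖ ≤
      Fintype.card κ * (4 ^ Fintype.card κ + 1) * (p : ℝ)⁻¹ := by
  have hp0 : (p : ℝ) ≠ 0 := by exact_mod_cast hp.ne_zero
  let _ := actSeminorm (κ × Bool)
  change ‖avgElem p W h - 1‖ ≤ _
  have hone : ‖(1 : MonoidAlgebra ℝ (κ × Bool → ℕ))‖ ≤ 1 := norm_act_one_le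
  have h1 : avgElem p W h - 1 = ∑ t : ZMod p, (p : ℝ)⁻¹ • (localElem p W h t - 1) := by
    rw [avgElem, ← Finset.smul_sum, ← Finset.smul_sum, Finset.sum_sub_distrib, smul_sub,
      Finset.sum_const, Finset.card_univ, ZMod.card, ← Nat.cast_smul_eq_nsmul ℝ, smul_smul,
      inv_mul_cancel₀ hp0, one_smul]
  have hcard : (Finset.univ : Finset (κ × Bool)).card = 2 * Fintype.card κ := by
    rw [Finset.card_univ, Fintype.card_prod, Fintype.card_bool, mul_comm]
  have hpt : ∀ t : ZMod p, ‖localElem p W h t - 1‖ ≤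
      ∑ i, rootInd p W (h i) t * (4 ^ Fintype.card κ + 1) := by
    intro t
    have hnn : ∀ i, 0 ≤ rootInd p W (h i) t * (4 ^ Fintype.card κ + 1) := fun i => by
      rcases rootInd_eq_zero_or_one p W (h i) t with h0 | h0 <;> rw [h0] <;> positivity
    by_cases hall : ∀ i, rootInd p W (h i) t = 0
    · have : localElem p W h t = 1 := by simp [localElem, hall]
      rw [this, sub_self, norm_zero]
      exact Finset.sum_nonneg fun i _ => hnn i
    · push Not at hall
      obtain ⟨i, hi⟩ := hall
      have hi1 := (rootInd_eq_zero_or_one p W (h i) t).resolve_left hi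
      refine le_trans ?_ (Finset.single_le_sum (fun i _ => hnn i) (Finset.mem_univ i))
      rw [hi1, one_mul]
      have h2 := norm_prod_one_sub_le hone
        (x := fun j => MonoidAlgebra.single (coordHom j p) (rootInd p W (h j.1) t))
        Finset.univ fun j _ => (norm_act_single_le _ _).trans (by
          rcases rootInd_eq_zero_or_one p W (h j.1) t with h0 | h0 <;> rw [h0] <;> norm_num)
      rw [hcard, pow_mul] at h2
      norm_num at h2
      exact (norm_sub_le _ _).trans (add_le_add h2 hone)
  rw [h1]
  calc _ ≤ ∑ t : ZMod p, (p : ℝ)⁻¹ * ∑ i, rootInd p W (h i) t * (4 ^ Fintype.card κ + 1) := by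
        refine norm_sum_le_of_le _ fun t _ => ?_
        rw [← mul_one (localElem p W h t - 1), ← Algebra.mul_smul_comm]
        refine (norm_mul_le _ _).trans ?_
        rw [mul_comm]
        refine mul_le_mul ?_ (hpt t) (norm_nonneg _) (by positivity)
        rw [MonoidAlgebra.one_def, MonoidAlgebra.smul_single, smul_eq_mul, mul_one]
        exact (norm_act_single_le _ _).trans_eq (abs_of_nonneg (by positivity))
    _ = _ := by
        rw [← Finset.mul_sum, Finset.sum_comm]
        simp only [← Finset.sum_mul, sum_rootInd hp hW]
        simp only [Finset.sum_const, Finset.card_univ, nsmul_eq_mul]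
        ring

/-- The loss at a prime `p` in the comparison with zeta factors; it is larger if the shifts
are not distinct mod `p`. -/
def localLoss (n p : ℕ) (bad : Prop) [Decidable bad] : ℝ :=
  1 + 4 ^ n * localConst n * if bad then (p : ℝ)⁻¹ else ((p : ℝ)⁻¹) ^ 2

theorem localLoss_pos (n p : ℕ) (bad : Prop) [Decidable bad] : 0 < localLoss n p bad := by
  have := localConst_pos n
  unfold localLoss
  split_ifs <;> positivity

/-- Multiplying by the denominators ∏(1 - y_i) instead of dividing leaves an element close to ∏(1 -
x_j). The factor 4^|κ| in the loss comes from the lower bound 1/2 for each of the 2|κ| factors. -/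
theorem norm_act_avgElem_mul_le {p W : ℕ} [NeZero p] (hp : p.Prime) (hW : ¬ p ∣ W) {h : κ → ℤ}
    {bad : Prop} [Decidable bad]
    (hbad : ¬ bad → ∀ i j, i ≠ j → (h i : ZMod p) ≠ (h j : ZMod p)) (f : (κ × Bool → ℕ) →ᵇ ℝ) :
    ‖act (avgElem p W h * ∏ i, (1 - MonoidAlgebra.single (pairHom i p) (p : ℝ)⁻¹)) f‖ ≤
      localLoss (Fintype.card κ) p bad *
        ‖act (∏ j : κ × Bool, (1 - MonoidAlgebra.single (coordHom j p) (p : ℝ)⁻¹)) f‖ := by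
  have hp2 : (2 : ℝ) ≤ p := by exact_mod_cast hp.two_le
  have hinv : (p : ℝ)⁻¹ ≤ 1 / 2 := by
    rw [one_div]; exact inv_anti₀ two_pos hp2
  have hinv0 : 0 ≤ (p : ℝ)⁻¹ := by positivity
  have hx : ∀ v : κ × Bool → ℕ, ‖act (MonoidAlgebra.single v (p : ℝ)⁻¹)‖ ≤ (p : ℝ)⁻¹ :=
    fun v => (norm_act_single_le v _).trans_eq (abs_of_nonneg hinv0)
  have hcard : Fintype.card (κ × Bool) = 2 * Fintype.card κ := by
    rw [Fintype.card_prod, Fintype.card_bool, mul_comm]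
  have key : ‖act (avgElem p W h * ∏ i, (1 - MonoidAlgebra.single (pairHom i p) (p : ℝ)⁻¹) -
      ∏ j : κ × Bool, (1 - MonoidAlgebra.single (coordHom j p) (p : ℝ)⁻¹))‖ ≤
      localConst (Fintype.card κ) * if bad then (p : ℝ)⁻¹ else ((p : ℝ)⁻¹) ^ 2 := by
    let := actSeminorm (κ × Bool)
    split_ifs with hb
    · exact norm_local_factor_sub_le (A := MonoidAlgebra ℝ (κ × Bool → ℕ)) norm_act_one_le hinv0
        (hinv.trans (by norm_num)) (fun j => hx _) (fun i => hx _)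
        (norm_act_avgElem_sub_one_le hp hW h)
    · rw [avgElem_eq_of_injective hp hW (hbad hb)]
      exact norm_local_factor_sub_le_sq (A := MonoidAlgebra ℝ (κ × Bool → ℕ)) norm_act_one_le hinv0
        (hinv.trans (by norm_num)) (fun j => hx _) (fun i => hx _)
  have h2 := norm_act_le_of_sub_le rfl (fun j => (hx (coordHom j p)).trans hinv) key f
  rw [hcard, pow_mul] at h2
  norm_num at h2
  rw [localLoss, mul_assoc]
  norm_num
  exact h2

/-- The product of the averaged local factors, applied to the weight function. -/
theorem abs_act_prod_avgElem_le {W : ℕ} {R B : ℝ} (hR : 1 ≤ R)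
    (hB : ∀ a b, |pairSum W R a b| ≤ B) (h : κ → ℤ) {bad : ℕ → Prop} [DecidablePred bad]
    (hbad : ∀ p, ¬ bad p → ∀ i j, i ≠ j → (h i : ZMod p) ≠ (h j : ZMod p))
    {x : ℕ → MonoidAlgebra ℝ (κ × Bool → ℕ)}
    (hx : ∀ p (_ : NeZero p), x p = avgElem p W h) (a : κ × Bool → ℕ) :
    |act (∏ p ∈ sievePrimes W ⌊R⌋₊, x p) (weightFn R) a| ≤
      (∏ p ∈ sievePrimes W ⌊R⌋₊, localLoss (Fintype.card κ) p (bad p)) *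
        B ^ Fintype.card κ := by
  set P := sievePrimes W ⌊R⌋₊
  have hB0 : 0 ≤ B := (abs_nonneg _).trans (hB 0 0)
  set g := act (∏ i : κ, pairElem W R i) (weightFn R)
  -- Writing the weight as the product of all denominators applied to g supplies every prime with
  -- its own denominator.
  have h1 : act (∏ p ∈ P, x p) (weightFn R) = act (∏ p ∈ P, (x p *
      ∏ i : κ, (1 - MonoidAlgebra.single (pairHom i p) (p : ℝ)⁻¹))) g := by
    rw [Finset.prod_mul_distrib, act_mul_apply, act_inverse_prod_apply W hR]
  have h2 : ‖act (∏ p ∈ P, ∏ j : κ × Bool,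
      (1 - MonoidAlgebra.single (coordHom j p) (p : ℝ)⁻¹)) g‖ ≤ B ^ Fintype.card κ := by
    rw [norm_le (by positivity)]
    intro b
    rw [act_pairElem_mul_apply W (by linarith), Real.norm_eq_abs, Finset.abs_prod]
    calc _ ≤ ∏ i : κ, B := Finset.prod_le_prod (fun _ _ => abs_nonneg _) fun i _ => hB _ _
      _ = _ := by simp
  have h3 := norm_act_prod_le (x := fun p => x p *
      ∏ i : κ, (1 - MonoidAlgebra.single (pairHom i p) (p : ℝ)⁻¹))
    (y := fun p => ∏ j : κ × Bool, (1 - MonoidAlgebra.single (coordHom j p) (p : ℝ)⁻¹)) P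
    (fun p _ => (localLoss_pos (Fintype.card κ) p (bad p)).le)
    (fun p hp f => by
      have hpp := prime_of_mem_sievePrimes hp
      have : NeZero p := ⟨hpp.ne_zero⟩
      rw [hx p ‹_›]
      exact norm_act_avgElem_mul_le hpp (mem_sievePrimes.1 hp).2.2 (hbad p) f) g
  rw [h1]
  refine (norm_coe_le_norm _ a).trans (h3.trans ?_)
  exact mul_le_mul_of_nonneg_left h2
    (Finset.prod_nonneg fun p _ => (localLoss_pos _ _ _).le)

end GoldstonYildirim
end

/-! ### Full periods by the Chinese remainder theorem, then intervals -/

noncomputable section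
namespace GoldstonYildirim

open BoundedContinuousFunction ArithmeticFunction
open scoped ArithmeticFunction.Moebius

section ChineseRemainder

variable {A : Type*} [CommRing A]

theorem sum_range_mul_sum_range_of_coprime {a b : ℕ} (ha : 0 < a) (hb : 0 < b) (hab : a.Coprime b)
    {F G : ℕ → A} (hF : ∀ k, F (k % a) = F k) (hG : ∀ k, G (k % b) = G k) :
    (∑ k ∈ Finset.range a, F k) * ∑ k ∈ Finset.range b, G k =
      ∑ k ∈ Finset.range (a * b), F k * G k := by
  rw [Finset.sum_mul_sum, ← Finset.sum_product']
  symm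
  refine Finset.sum_bij' (fun k _ => (k % a, k % b))
    (fun q _ => (Nat.chineseRemainder hab q.1 q.2 : ℕ)) ?_ ?_ ?_ ?_ ?_
  · intro k _
    exact Finset.mem_product.2 ⟨Finset.mem_range.2 (Nat.mod_lt _ ha),
      Finset.mem_range.2 (Nat.mod_lt _ hb)⟩
  · intro q _
    exact Finset.mem_range.2 (Nat.chineseRemainder_lt_mul hab _ _ ha.ne' hb.ne')
  · intro k hk
    symm
    have h := Nat.chineseRemainder_modEq_unique hab
      (a := k % a) (b := k % b) (z := k) (Nat.mod_modEq k a).symm (Nat.mod_modEq k b).symm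
    exact Nat.ModEq.eq_of_lt_of_lt h (Finset.mem_range.1 hk)
      (Nat.chineseRemainder_lt_mul hab _ _ ha.ne' hb.ne')
  · intro q hq
    obtain ⟨h1, h2⟩ := Finset.mem_product.1 hq
    have h := (Nat.chineseRemainder hab q.1 q.2).2
    refine Prod.ext ?_ ?_
    · exact (Nat.ModEq.eq_1 a _ _ ▸ h.1 : _ % a = q.1 % a).trans
        (Nat.mod_eq_of_lt (Finset.mem_range.1 h1))
    · exact (Nat.ModEq.eq_1 b _ _ ▸ h.2 : _ % b = q.2 % b).trans
        (Nat.mod_eq_of_lt (Finset.mem_range.1 h2))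
  · intro k _
    rw [hF, hG]

theorem prod_sum_range_of_primes {P : Finset ℕ} (hP : ∀ p ∈ P, p.Prime) {F : ℕ → ℕ → A}
    (hF : ∀ p k, F p (k % p) = F p k) :
    ∏ p ∈ P, ∑ k ∈ Finset.range p, F p k =
      ∑ k ∈ Finset.range (∏ p ∈ P, p), ∏ p ∈ P, F p k := by
  induction P using Finset.induction_on with
  | empty => simp
  | insert q P hq ih =>
    have hP' : ∀ p ∈ P, p.Prime := fun p hp => hP p (Finset.mem_insert_of_mem hp)
    have hqp := hP q (Finset.mem_insert_self q P)
    rw [Finset.prod_insert hq, ih hP', Finset.prod_insert hq,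
      sum_range_mul_sum_range_of_coprime hqp.pos
        (Finset.prod_pos fun p hp => (hP' p hp).pos)
        (Nat.Coprime.prod_right fun p hp => (Nat.coprime_primes hqp (hP' p hp)).2
          fun h => hq (h ▸ hp)) (hF q) fun k => ?_]
    · exact Finset.sum_congr rfl fun k _ => by rw [Finset.prod_insert hq]
    · refine Finset.prod_congr rfl fun p hp => ?_
      rw [← hF p, Nat.mod_mod_of_dvd _ (Finset.dvd_prod_of_mem _ hp), hF]

theorem sum_zmod_eq_sum_range {p : ℕ} [NeZero p] (f : ZMod p → A) :
    ∑ t : ZMod p, f t = ∑ k ∈ Finset.range p, f (k : ZMod p) := by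
  refine Finset.sum_bij' (fun t _ => t.val) (fun k _ => (k : ZMod p)) ?_ ?_ ?_ ?_ ?_
  · intro t _; exact Finset.mem_range.2 (ZMod.val_lt t)
  · intro k _; exact Finset.mem_univ _
  · intro t _; exact ZMod.natCast_zmod_val t
  · intro k hk; exact ZMod.val_cast_of_lt (Finset.mem_range.1 hk)
  · intro t _; rw [ZMod.natCast_zmod_val]

end ChineseRemainder

section Pointwise

variable {κ : Type*} [DecidableEq κ] [Fintype κ]

theorem rootInd_intCast (p W : ℕ) (h x : ℤ) :
    rootInd p W h (x : ZMod p) = if (p : ℤ) ∣ W * (x + h) + 1 then 1 else 0 := by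
  unfold rootInd
  congr 1
  rw [← ZMod.intCast_zmod_eq_zero_iff_dvd]
  push_cast
  rfl

theorem natCast_dvd_iff_forall_primeFactors {d : ℕ} (hd : Squarefree d) (n : ℤ) :
    (d : ℤ) ∣ n ↔ ∀ p ∈ d.primeFactors, (p : ℤ) ∣ n := by
  simp only [Int.natCast_dvd]
  constructor
  · exact fun h p hp => (Nat.dvd_of_mem_primeFactors hp).trans h
  · intro h
    rw [← Nat.prod_primeFactors_of_squarefree hd]
    exact Finset.prod_primes_dvd _ (fun p hp => (Nat.prime_of_mem_primeFactors hp).prime) h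

theorem prod_primeFactors_rootInd {d : ℕ} (hd : Squarefree d) (W : ℕ) (h x : ℤ) :
    ∏ p ∈ d.primeFactors, rootInd p W h (x : ZMod p) =
      if (d : ℤ) ∣ W * (x + h) + 1 then 1 else 0 := by
  simp only [rootInd_intCast]
  by_cases hdvd : (d : ℤ) ∣ W * (x + h) + 1
  · rw [if_pos hdvd]
    exact Finset.prod_eq_one fun p hp =>
      if_pos ((natCast_dvd_iff_forall_primeFactors hd _).1 hdvd p hp)
  · rw [if_neg hdvd]
    rw [natCast_dvd_iff_forall_primeFactors hd] at hdvd
    push Not at hdvd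
    obtain ⟨p, hp, hpn⟩ := hdvd
    exact Finset.prod_eq_zero hp (if_neg hpn)

/-- A Bézout relation. This is why only divisors coprime to W occur in the sieve. -/
theorem coprime_of_dvd_mul_add_one {d W : ℕ} {y : ℤ} (h : (d : ℤ) ∣ W * y + 1) : d.Coprime W := by
  rw [← Nat.isCoprime_iff_coprime]
  obtain ⟨c, hc⟩ := h
  exact ⟨c, -y, by linear_combination -hc⟩

theorem truncLambda_eq_sum_divisors (W : ℕ) {R : ℝ} (hR : 0 ≤ R) (h x : ℤ) :
    ∑ d ∈ (∏ p ∈ sievePrimes W ⌊R⌋₊, p).divisors,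
      ((μ d : ℝ) * ∏ p ∈ d.primeFactors, rootInd p W h (x : ZMod p)) * Real.posLog (R / d) =
      truncLambda R (W * (x + h) + 1) := by
  have h1 := sum_divisors_prod_sievePrimes W ⌊R⌋₊
    (F := fun d => (if (d : ℤ) ∣ W * (x + h) + 1 then 1 else 0) * Real.posLog (R / d))
    fun d hd => by rw [posLog_div_eq_zero hd hR, mul_zero]
  calc _ = _ := Finset.sum_congr rfl fun d _ => by
        rw [mul_assoc]
        exact moebius_mul_congr_of_squarefree
          (f := fun d => (∏ p ∈ d.primeFactors, rootInd p W h (x : ZMod p)) * Real.posLog (R / d))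
          (g := fun d => (if (d : ℤ) ∣ W * (x + h) + 1 then 1 else 0) * Real.posLog (R / d))
          fun hd => by simp only [prod_primeFactors_rootInd hd]
    _ = _ := h1
    _ = _ := by
        rw [truncLambda, Finset.sum_filter]
        refine Finset.sum_congr rfl fun d hd => ?_
        split_ifs with hdvd
        · obtain ⟨hd1, hd2⟩ := Finset.mem_Icc.1 hd
          have hd0 : (0 : ℝ) < d := by exact_mod_cast hd1
          rw [coprimeInd, if_pos (coprime_of_dvd_mul_add_one hdvd), Real.posLog_eq_log]
          · ring
          · rw [abs_of_nonneg (by positivity), one_le_div hd0]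
            exact (Nat.le_floor_iff hR).1 hd2
        · simp

/-- For fixed x the product over p reassembles, in each coordinate, the Möbius sum over d ∣ W(x + h)
+ 1; evaluating at the tuple 1 leaves the weights log⁺(R/d). -/
theorem act_prod_localElem_apply_one (W : ℕ) {R : ℝ} (hR : 0 ≤ R) (h : κ → ℤ) (x : ℤ) :
    act (∏ p ∈ sievePrimes W ⌊R⌋₊, localElem p W h (x : ZMod p)) (weightFn R) 1 =
      ∏ j : κ × Bool, truncLambda R (W * (x + h j.1) + 1) := by
  simp only [localElem]
  rw [Finset.prod_comm]
  have hexp : ∀ j : κ × Bool, ∏ p ∈ sievePrimes W ⌊R⌋₊,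
      (1 - MonoidAlgebra.single (coordHom j p) (rootInd p W (h j.1) (x : ZMod p))) =
      ∑ d ∈ (∏ p ∈ sievePrimes W ⌊R⌋₊, p).divisors, MonoidAlgebra.single (coordHom j d)
        ((μ d : ℝ) * ∏ p ∈ d.primeFactors, rootInd p W (h j.1) (x : ZMod p)) := fun j =>
    prod_one_sub_single (coordHom j) (fun p => rootInd p W (h j.1) (x : ZMod p))
      fun p hp => prime_of_mem_sievePrimes hp
  simp only [hexp]
  rw [act_prod_apply_of_separated (u := fun j a => Real.posLog (R / a j))
    (w := fun j a => ∑ d ∈ (∏ p ∈ sievePrimes W ⌊R⌋₊, p).divisors,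
      ((μ d : ℝ) * ∏ p ∈ d.primeFactors, rootInd p W (h j.1) (x : ZMod p)) *
        Real.posLog (R / ((a j * d : ℕ) : ℝ))) ?_ ?_ ?_ (weightFn_apply hR)]
  · refine Finset.prod_congr rfl fun j _ => ?_
    rw [← truncLambda_eq_sum_divisors W hR]
    simp
  · intro i j k a hij
    simp [coordHom_apply_of_ne hij]
  · intro i j k a hij
    simp [coordHom_apply_of_ne hij]
  · intro j a
    simp only [Pi.mul_apply, coordHom_apply_self]

/-- The sum over a full period of the product of truncated divisor sums. -/
theorem sum_range_prod_truncLambda_le {W : ℕ} {R B : ℝ} (hR : 1 ≤ R)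
    (hB : ∀ a b, |pairSum W R a b| ≤ B) (h : κ → ℤ) {bad : ℕ → Prop} [DecidablePred bad]
    (hbad : ∀ p, ¬ bad p → ∀ i j, i ≠ j → (h i : ZMod p) ≠ (h j : ZMod p)) :
    ∑ k ∈ Finset.range (∏ p ∈ sievePrimes W ⌊R⌋₊, p),
      ∏ j : κ × Bool, truncLambda R (W * ((k : ℤ) + h j.1) + 1) ≤
    ((∏ p ∈ sievePrimes W ⌊R⌋₊, p : ℕ) : ℝ) *
      ((∏ p ∈ sievePrimes W ⌊R⌋₊, localLoss (Fintype.card κ) p (bad p)) *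
        B ^ Fintype.card κ) := by
  set P := sievePrimes W ⌊R⌋₊
  have hP : ∀ p ∈ P, p.Prime := fun p hp => prime_of_mem_sievePrimes hp
  -- The average written over `Finset.range p`: it makes sense for every p without `NeZero p` and
  -- has the shape needed for the Chinese remainder theorem.
  set x : ℕ → MonoidAlgebra ℝ (κ × Bool → ℕ) := fun p =>
    ∑ k ∈ Finset.range p, (p : ℝ)⁻¹ • localElem p W h (k : ZMod p) with hx
  have hxavg : ∀ p (_ : NeZero p), x p = avgElem p W h := fun p _ =>
    (sum_zmod_eq_sum_range fun t : ZMod p => (p : ℝ)⁻¹ • localElem p W h t).symm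
  have h1 := abs_act_prod_avgElem_le hR hB h hbad hxavg 1
  have h2 : ∏ p ∈ P, x p = ∑ k ∈ Finset.range (∏ p ∈ P, p),
      ((∏ p ∈ P, p : ℕ) : ℝ)⁻¹ • ∏ p ∈ P, localElem p W h (((k : ℤ)) : ZMod p) := by
    rw [prod_sum_range_of_primes hP fun p k => by rw [ZMod.natCast_mod]]
    refine Finset.sum_congr rfl fun k _ => ?_
    rw [Finset.prod_smul, Nat.cast_prod, Finset.prod_inv_distrib]
    simp only [Int.cast_natCast]
  have hQ : (0 : ℝ) < ((∏ p ∈ P, p : ℕ) : ℝ) := by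
    exact_mod_cast Finset.prod_pos fun p hp => (hP p hp).pos
  have h3 : act (∏ p ∈ P, x p) (weightFn R) 1 = ((∏ p ∈ P, p : ℕ) : ℝ)⁻¹ *
      ∑ k ∈ Finset.range (∏ p ∈ P, p),
        ∏ j : κ × Bool, truncLambda R (W * ((k : ℤ) + h j.1) + 1) := by
    rw [h2, ← Finset.smul_sum, map_smul, map_sum]
    change ((∏ p ∈ P, p : ℕ) : ℝ)⁻¹ * ((∑ k ∈ Finset.range (∏ p ∈ P, p), act
      (∏ p ∈ P, localElem p W h ((k : ℤ) : ZMod p))) (weightFn R)) 1 = _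
    rw [_root_.sum_apply, coe_sum, Finset.sum_apply]
    congr 1
    exact Finset.sum_congr rfl fun k _ => act_prod_localElem_apply_one W (by linarith) h k
  rw [h3] at h1
  have h4 := (le_abs_self _).trans h1
  rwa [inv_mul_le_iff₀ hQ] at h4

end Pointwise

section Periodic

variable {g : ℤ → ℝ} {D : ℕ}

theorem sum_range_periodic (hg : Function.Periodic g D) (a : ℤ) :
    ∑ i ∈ Finset.range D, g (a + i) = ∑ i ∈ Finset.range D, g i := by
  have hstep : ∀ a : ℤ, ∑ i ∈ Finset.range D, g (a + 1 + i) = ∑ i ∈ Finset.range D, g (a + i) := by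
    intro a
    have h1 := Finset.sum_range_succ' (fun i : ℕ => g (a + i)) D
    rw [Finset.sum_range_succ, hg a] at h1
    simp only [Nat.cast_add, Nat.cast_one, Nat.cast_zero, add_zero] at h1
    rw [add_right_cancel h1]
    exact Finset.sum_congr rfl fun i _ => by congr 1; ring
  induction a using Int.induction_on with
  | zero => simp
  | succ n ih => rw [hstep, ih]
  | pred n ih => rw [← ih, ← hstep]; simp

theorem sum_range_mul_periodic (hg : Function.Periodic g D) (a : ℤ) (q : ℕ) :
    ∑ i ∈ Finset.range (q * D), g (a + i) = q * ∑ i ∈ Finset.range D, g i := by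
  induction q with
  | zero => simp
  | succ q ih =>
    rw [Nat.succ_mul, Finset.sum_range_add, ih, ← sum_range_periodic hg (a + (q * D : ℕ))]
    push_cast
    rw [add_mul, one_mul]
    congr 1
    exact Finset.sum_congr rfl fun i _ => by congr 1; ring

/-- Whole periods contribute exactly their mean; only one incomplete period is left. -/
theorem abs_sum_range_sub_le (hg : Function.Periodic g D) (hD : 0 < D) (h0 : ∀ x, 0 ≤ g x)
    (h1 : ∀ x, g x ≤ 1) (a : ℤ) (L : ℕ) :
    |∑ i ∈ Finset.range L, g (a + i) - L * ((∑ i ∈ Finset.range D, g i) / D)| ≤ D := by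
  have hD' : (0 : ℝ) < D := by exact_mod_cast hD
  have hL : L = L / D * D + L % D := (Nat.div_add_mod' L D).symm
  set q := L / D
  set r := L % D
  have hr : (r : ℝ) ≤ D := by exact_mod_cast (Nat.mod_lt L hD).le
  set S := ∑ i ∈ Finset.range D, g i
  have hS0 : 0 ≤ S / D := div_nonneg (Finset.sum_nonneg fun i _ => h0 _) hD'.le
  have hS1 : S / D ≤ 1 := by
    rw [div_le_one hD']
    exact (Finset.sum_le_sum fun i _ => h1 _).trans_eq (by simp)
  set T := ∑ i ∈ Finset.range r, g (a + ((q * D + i : ℕ) : ℤ))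
  have hT0 : 0 ≤ T := Finset.sum_nonneg fun i _ => h0 _
  have hT1 : T ≤ r := (Finset.sum_le_sum fun i _ => h1 _).trans_eq (by simp)
  have hsum : ∑ i ∈ Finset.range L, g (a + i) = q * S + T := by
    conv_lhs => rw [hL]
    rw [Finset.sum_range_add, sum_range_mul_periodic hg]
  have hLr : (L : ℝ) = q * D + r := by exact_mod_cast hL
  have hmain : ∑ i ∈ Finset.range L, g (a + i) - L * (S / D) = T - r * (S / D) := by
    rw [hsum, hLr]; field_simp; ring
  rw [hmain, abs_le]
  constructor <;> nlinarith

/-- Both means equal the mean over DQ consecutive integers. -/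
theorem mean_eq_of_periodic {Q : ℕ} (hD : 0 < D) (hQ : 0 < Q) (hg : Function.Periodic g D)
    (hg' : Function.Periodic g Q) :
    (∑ i ∈ Finset.range D, g i) / D = (∑ i ∈ Finset.range Q, g i) / Q := by
  have h1 := sum_range_mul_periodic hg 0 Q
  have h2 := sum_range_mul_periodic hg' 0 D
  rw [mul_comm D Q, h1] at h2
  have hD' : (0 : ℝ) < D := by exact_mod_cast hD
  have hQ' : (0 : ℝ) < Q := by exact_mod_cast hQ
  rw [div_eq_div_iff hD'.ne' hQ'.ne']
  linarith

end Periodic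

section Interval

variable {ι : Type*} [Fintype ι]

/-- The indicator function of `d j ∣ W (x + h j) + 1` for all `j`. -/
def dvdInd (W : ℕ) (h : ι → ℤ) (d : ι → ℕ) (x : ℤ) : ℝ :=
  ∏ j, if (d j : ℤ) ∣ W * (x + h j) + 1 then 1 else 0

theorem dvdInd_nonneg (W : ℕ) (h : ι → ℤ) (d : ι → ℕ) (x : ℤ) : 0 ≤ dvdInd W h d x :=
  Finset.prod_nonneg fun _ _ => by split_ifs <;> norm_num

theorem dvdInd_le_one (W : ℕ) (h : ι → ℤ) (d : ι → ℕ) (x : ℤ) : dvdInd W h d x ≤ 1 :=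
  Finset.prod_le_one (fun _ _ => by split_ifs <;> norm_num) fun _ _ => by split_ifs <;> norm_num

theorem periodic_dvdInd (W : ℕ) (h : ι → ℤ) {d : ι → ℕ} {Q : ℕ} (hQ : ∀ j, d j ∣ Q) :
    Function.Periodic (dvdInd W h d) Q := by
  intro x
  refine Finset.prod_congr rfl fun j _ => ?_
  have h1 : (W : ℤ) * (x + Q + h j) + 1 = W * (x + h j) + 1 + W * Q := by ring
  have h2 : (d j : ℤ) ∣ W * Q := Dvd.dvd.mul_left (Int.natCast_dvd_natCast.2 (hQ j)) _
  have h3 : (d j : ℤ) ∣ W * (x + Q + h j) + 1 ↔ (d j : ℤ) ∣ W * (x + h j) + 1 := by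
    rw [h1, dvd_add_left h2]
  simp only [h3]

variable [DecidableEq ι]

theorem prod_truncLambda_eq (W : ℕ) (R : ℝ) (h : ι → ℤ) (x : ℤ) :
    ∏ j, truncLambda R (W * (x + h j) + 1) =
      ∑ d ∈ Fintype.piFinset fun _ : ι => Finset.Icc 1 ⌊R⌋₊,
        (∏ j, (μ (d j) : ℝ) * Real.log (R / d j)) * dvdInd W h d x := by
  simp only [truncLambda, Finset.sum_filter]
  rw [Finset.prod_univ_sum]
  refine Finset.sum_congr rfl fun d _ => ?_
  rw [dvdInd, ← Finset.prod_mul_distrib]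
  exact Finset.prod_congr rfl fun j _ => by split_ifs <;> simp

/-- Let n = |ι|. There are at most R^n divisor tuples, with coefficients at most R^n, and each
divisibility condition has period ∏ d_j ≤ R^n. The error must come from this short period; Q may be
far larger and enters only through the equality of means. -/
theorem abs_sum_prod_truncLambda_sub_le (W : ℕ) {R : ℝ} (hR : 1 ≤ R) (h : ι → ℤ) (a : ℤ)
    (L : ℕ) :
    |∑ i ∈ Finset.range L, ∏ j, truncLambda R (W * (a + i + h j) + 1) -
      L * ((∑ i ∈ Finset.range (∏ p ∈ sievePrimes W ⌊R⌋₊, p),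
        ∏ j, truncLambda R (W * ((i : ℤ) + h j) + 1)) /
          ((∏ p ∈ sievePrimes W ⌊R⌋₊, p : ℕ) : ℝ))| ≤ R ^ (3 * Fintype.card ι) := by
  set Q := ∏ p ∈ sievePrimes W ⌊R⌋₊, p with hQ_def
  have hQ : 0 < Q := Nat.pos_of_ne_zero (prod_sievePrimes_ne_zero W ⌊R⌋₊)
  set n := Fintype.card ι
  set c : (ι → ℕ) → ℝ := fun d => ∏ j, (μ (d j) : ℝ) * Real.log (R / d j) with hc
  set T := Fintype.piFinset fun _ : ι => Finset.Icc 1 ⌊R⌋₊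
  have hfloor : (⌊R⌋₊ : ℝ) ≤ R := Nat.floor_le (by linarith)
  have hT : ∀ d ∈ T, ∀ j, 1 ≤ d j ∧ d j ≤ ⌊R⌋₊ := fun d hd j =>
    Finset.mem_Icc.1 (Fintype.mem_piFinset.1 hd j)
  have hcabs : ∀ d ∈ T, |c d| ≤ R ^ n := by
    intro d hd
    rw [hc, Finset.abs_prod]
    calc _ ≤ ∏ _j : ι, R := by
          refine Finset.prod_le_prod (fun _ _ => abs_nonneg _) fun j _ => ?_
          obtain ⟨h1, h2⟩ := hT d hd j
          have hd0 : (0 : ℝ) < d j := by exact_mod_cast h1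
          have hd1 : (1 : ℝ) ≤ d j := by exact_mod_cast h1
          have hdR : (d j : ℝ) ≤ R := (Nat.le_floor_iff (by linarith)).1 h2
          have hq1 : 1 ≤ R / d j := (one_le_div hd0).2 hdR
          have hlog0 : 0 ≤ Real.log (R / d j) := Real.log_nonneg hq1
          have hlog1 : Real.log (R / d j) ≤ R :=
            (Real.log_le_self (by linarith)).trans (div_le_self (by linarith) hd1)
          rw [abs_mul, abs_of_nonneg hlog0]
          calc _ ≤ 1 * R := mul_le_mul (abs_moebius_real_le_one _) hlog1 hlog0 zero_le_one
            _ = R := one_mul R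
      _ = R ^ n := by simp [n]
  have hmean : ∀ d ∈ T, |c d * (∑ i ∈ Finset.range L, dvdInd W h d (a + i) -
      L * ((∑ i ∈ Finset.range Q, dvdInd W h d i) / Q))| ≤ R ^ n * R ^ n := by
    intro d hd
    have hDpos : 0 < ∏ j, d j := Finset.prod_pos fun j _ => (hT d hd j).1
    have hper : Function.Periodic (dvdInd W h d) ((∏ j, d j : ℕ) : ℤ) :=
      periodic_dvdInd W h fun j => Finset.dvd_prod_of_mem _ (Finset.mem_univ j)
    -- If some d_j is not squarefree the coefficient vanishes; if some d_j is not coprime to W the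
    -- condition never holds. Otherwise every d_j divides Q.
    by_cases hsq : ∀ j, Squarefree (d j)
    swap
    · push Not at hsq
      obtain ⟨j, hj⟩ := hsq
      have : c d = 0 := Finset.prod_eq_zero (Finset.mem_univ j)
        (by rw [moebius_eq_zero_of_not_squarefree hj]; simp)
      rw [this, zero_mul, abs_zero]
      positivity
    by_cases hcop : ∀ j, (d j).Coprime W
    swap
    · push Not at hcop
      obtain ⟨j, hj⟩ := hcop
      have : ∀ x, dvdInd W h d x = 0 := fun x => Finset.prod_eq_zero (Finset.mem_univ j)
        (if_neg fun h' => hj (coprime_of_dvd_mul_add_one h'))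
      simp only [this, Finset.sum_const_zero, zero_div, mul_zero, sub_zero, abs_zero]
      positivity
    have hdQ : ∀ j, d j ∣ Q := fun j => dvd_prod_sievePrimes (hsq j) (hT d hd j).2 (hcop j)
    rw [abs_mul, ← mean_eq_of_periodic hDpos hQ hper (periodic_dvdInd W h hdQ)]
    refine mul_le_mul (hcabs d hd) ?_ (abs_nonneg _) (by positivity)
    refine (abs_sum_range_sub_le hper hDpos (dvdInd_nonneg W h d) (dvdInd_le_one W h d) a L).trans ?_
    push_cast
    calc ∏ j, (d j : ℝ) ≤ ∏ _j : ι, R := Finset.prod_le_prod (fun _ _ => by positivity) fun j _ =>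
          (Nat.le_floor_iff (by linarith)).1 (hT d hd j).2
      _ = R ^ n := by simp [n]
  have hsplit : ∑ i ∈ Finset.range L, ∏ j, truncLambda R (W * (a + i + h j) + 1) -
      L * ((∑ i ∈ Finset.range Q, ∏ j, truncLambda R (W * ((i : ℤ) + h j) + 1)) / Q) =
      ∑ d ∈ T, c d * (∑ i ∈ Finset.range L, dvdInd W h d (a + i) -
        L * ((∑ i ∈ Finset.range Q, dvdInd W h d i) / Q)) := by
    simp only [prod_truncLambda_eq]
    rw [Finset.sum_comm, Finset.sum_comm (s := Finset.range Q), Finset.sum_div, Finset.mul_sum,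
      ← Finset.sum_sub_distrib]
    refine Finset.sum_congr rfl fun d _ => ?_
    rw [← Finset.mul_sum, ← Finset.mul_sum]
    ring
  rw [hsplit]
  refine (Finset.abs_sum_le_sum_abs _ _).trans ((Finset.sum_le_sum hmean).trans ?_)
  have hcard : T.card = ⌊R⌋₊ ^ n := by
    simp [T, n]
  rw [Finset.sum_const, nsmul_eq_mul, hcard]
  push_cast
  calc (⌊R⌋₊ : ℝ) ^ n * (R ^ n * R ^ n) ≤ R ^ n * (R ^ n * R ^ n) := by gcongr
    _ = _ := by ring

end Interval

end GoldstonYildirim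
end

/-! ### Integer points of B, error terms and the choice of w₀ -/

noncomputable section

namespace GoldstonYildirim

/-- The integer points of a bounded interval are consecutive. Rounding the endpoints needs a
correction by one when an integral endpoint is missing, and this still leaves at least diam B - 1
points. -/
theorem exists_intAverage_eq {B : Set ℝ} (hB : B.OrdConnected) (hb : Bornology.IsBounded B)
    (hd : 1 < Metric.diam B) :
    ∃ (a : ℤ) (L : ℕ), Metric.diam B - 1 ≤ L ∧
      ∀ f : ℤ → ℝ, intAverage B f = (∑ i ∈ Finset.range L, f (a + i)) / L := by
  rw [Real.diam_eq hb] at hd ⊢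
  have hne : B.Nonempty := by
    by_contra h
    rw [Set.not_nonempty_iff_eq_empty] at h
    norm_num [h] at hd
  set s := sInf B
  set u := sSup B
  have hs : ∀ x ∈ B, s ≤ x := fun x hx => csInf_le hb.bddBelow hx
  have hu : ∀ x ∈ B, x ≤ u := fun x hx => le_csSup hb.bddAbove hx
  have hmem : ∀ x, s < x → x < u → x ∈ B := by
    intro x h1 h2
    obtain ⟨y, hy, hyx⟩ := exists_lt_of_csInf_lt hne h1
    obtain ⟨z, hz, hxz⟩ := exists_lt_of_lt_csSup hne h2
    exact hB.out hy hz ⟨hyx.le, hxz.le⟩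
  obtain ⟨lo, hlo, hlo1, hlo2⟩ : ∃ lo : ℤ, (lo : ℝ) ≤ s + 1 ∧ (∀ x : ℤ, (x : ℝ) ∈ B → lo ≤ x) ∧
      ∀ x : ℤ, lo ≤ x → (x : ℝ) < u → (x : ℝ) ∈ B := by
    have h1 := Int.le_ceil s
    have h2 := Int.ceil_lt_add_one s
    by_cases h : (⌈s⌉ : ℝ) ∈ B
    · refine ⟨⌈s⌉, h2.le, fun x hx => Int.ceil_le.2 (hs x hx), fun x hx hxu => ?_⟩
      rcases hx.eq_or_lt with rfl | hx
      · exact h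
      · exact hmem x (h1.trans_lt (by exact_mod_cast hx)) hxu
    · have h3 : (⌈s⌉ : ℝ) ≤ s := by
        by_contra! h'
        exact h (hmem _ h' (by linarith))
      refine ⟨⌈s⌉ + 1, by push_cast; linarith, fun x hx => ?_, fun x hx hxu => ?_⟩
      · rcases (Int.ceil_le.2 (hs x hx)).eq_or_lt with h' | h'
        · exact absurd (h' ▸ hx) h
        · exact h'
      · exact hmem x (h1.trans_lt (by exact_mod_cast hx)) hxu
  obtain ⟨hi, hhi, hhi1, hhi2⟩ : ∃ hi : ℤ, u - 1 ≤ hi ∧ (∀ x : ℤ, (x : ℝ) ∈ B → x ≤ hi) ∧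
      ∀ x : ℤ, x ≤ hi → s < (x : ℝ) → (x : ℝ) ∈ B := by
    have h1 := Int.floor_le u
    have h2 := Int.sub_one_lt_floor u
    by_cases h : (⌊u⌋ : ℝ) ∈ B
    · refine ⟨⌊u⌋, h2.le, fun x hx => Int.le_floor.2 (hu x hx), fun x hx hxs => ?_⟩
      rcases hx.eq_or_lt with rfl | hx
      · exact h
      · exact hmem x hxs (lt_of_lt_of_le (by exact_mod_cast hx) h1)
    · have h3 : u ≤ (⌊u⌋ : ℝ) := by
        by_contra! h'
        exact h (hmem _ (by linarith) h')
      refine ⟨⌊u⌋ - 1, by push_cast; linarith, fun x hx => ?_, fun x hx hxs => ?_⟩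
      · rcases (Int.le_floor.2 (hu x hx)).eq_or_lt with h' | h'
        · exact absurd (h' ▸ hx) h
        · exact Int.le_sub_one_of_lt h'
      · exact hmem x hxs (lt_of_lt_of_le (by exact_mod_cast Int.lt_of_le_sub_one hx) h1)
  set L := (hi + 1 - lo).toNat
  have hset : {x : ℤ | (x : ℝ) ∈ B} =
      ((Finset.range L).image fun i : ℕ => lo + (i : ℤ) : Finset ℤ) := by
    ext x
    simp only [Set.mem_ofPred_eq, Finset.coe_image, Set.mem_image, Finset.mem_coe,
      Finset.mem_range]
    constructor
    · intro hx
      have h1 := hlo1 x hx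
      have h2 := hhi1 x hx
      exact ⟨(x - lo).toNat, by omega, by omega⟩
    · rintro ⟨i, hi', rfl⟩
      have h1 : lo ≤ lo + (i : ℤ) := by omega
      have h2 : lo + (i : ℤ) ≤ hi := by omega
      -- Each of `hlo2`, `hhi2` settles one end. A point not below u lies above s, since the
      -- diameter is positive.
      by_cases hxu : ((lo + (i : ℤ) : ℤ) : ℝ) < u
      · exact hlo2 _ h1 hxu
      · exact hhi2 _ h2 (by linarith)
  have hinj : Set.InjOn (fun i : ℕ => lo + (i : ℤ)) (Finset.range L : Finset ℕ) :=
    fun i _ j _ hij => by simpa using hij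
  refine ⟨lo, L, ?_, fun f => ?_⟩
  · have h1 : ((hi + 1 - lo : ℤ) : ℝ) ≤ L := by exact_mod_cast Int.self_le_toNat _
    push_cast at h1
    linarith
  · rw [intAverage, hset, finsum_mem_coe_finset, Set.ncard_coe_finset, Finset.sum_image hinj,
      Finset.card_image_of_injOn hinj, Finset.card_range]

/-- Diagonal argument: g N is the largest v ≤ N such that P holds at N for all v' ≤ v. -/
theorem exists_tendsto_atTop_forall_le {P : ℕ → ℕ → Prop} (hP : ∀ v, ∀ᶠ N in atTop, P v N) :
    ∃ g : ℕ → ℕ, Tendsto g atTop atTop ∧ ∀ᶠ N in atTop, ∀ v ≤ g N, P v N := by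
  classical
  have hQ : ∀ v, ∀ᶠ N in atTop, ∀ v' ≤ v, P v' N := fun v =>
    (eventually_all_finite (Set.finite_Iic v)).2 fun v' _ => hP v'
  refine ⟨fun N => Nat.findGreatest (fun v => ∀ v' ≤ v, P v' N) N, tendsto_atTop.2 fun v => ?_, ?_⟩
  · filter_upwards [hQ v, eventually_ge_atTop v] with N h1 h2
    exact Nat.le_findGreatest h2 h1
  · filter_upwards [hQ 0] with N h
    exact Nat.findGreatest_spec (P := fun v => ∀ v' ≤ v, P v' N) (Nat.zero_le N) h

theorem lt_of_mem_sievePrimes_primorial {v N p : ℕ} (hp : p ∈ sievePrimes (primorial v) N) :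
    v < p := by
  obtain ⟨-, h1, h2⟩ := mem_sievePrimes.1 hp
  by_contra! h
  exact h2 (Finset.dvd_prod_of_mem _ (Finset.mem_filter.2
    ⟨Finset.mem_range.2 (Nat.lt_succ_of_le h), h1⟩))

theorem sum_sievePrimes_inv_sq_le {v : ℕ} (hv : v ≠ 0) (N : ℕ) :
    ∑ p ∈ sievePrimes (primorial v) N, ((p : ℝ)⁻¹) ^ 2 ≤ (v : ℝ)⁻¹ := by
  have h1 : sievePrimes (primorial v) N ⊆ Finset.Ioc v (max v N) := fun p hp =>
    Finset.mem_Ioc.2 ⟨lt_of_mem_sievePrimes_primorial hp,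
      (mem_sievePrimes.1 hp).1.trans (le_max_right _ _)⟩
  calc _ ≤ ∑ p ∈ Finset.Ioc v (max v N), ((p : ℝ)⁻¹) ^ 2 :=
        Finset.sum_le_sum_of_subset_of_nonneg h1 fun _ _ _ => by positivity
    _ = ∑ p ∈ Finset.Ioc v (max v N), ((p : ℝ) ^ 2)⁻¹ := by simp only [inv_pow]
    _ ≤ (v : ℝ)⁻¹ - ((max v N : ℕ) : ℝ)⁻¹ := sum_Ioc_inv_sq_le_sub hv (le_max_left _ _)
    _ ≤ (v : ℝ)⁻¹ := sub_le_self _ (by positivity)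

/-- For primes dividing D, p⁻¹ ≤ p^{-1/2}. The other primes all exceed v, so their p⁻² sum to at
most 1/v and 1 + t ≤ exp t finishes. -/
theorem prod_localLoss_le {v : ℕ} (hv : v ≠ 0) (n N : ℕ) {D : ℕ} (hD : D ≠ 0) :
    ∏ p ∈ sievePrimes (primorial v) N, localLoss n p (p ∣ D) ≤
      (∏ p ∈ D.primeFactors, (1 + 4 ^ n * localConst n * (p : ℝ) ^ (-(1 / 2) : ℝ))) *
        Real.exp (4 ^ n * localConst n * (v : ℝ)⁻¹) := by
  set P := sievePrimes (primorial v) N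
  set C := 4 ^ n * localConst n with hC_def
  have hC : 0 ≤ C := by have := localConst_pos n; positivity
  rw [← Finset.prod_filter_mul_prod_filter_not P (fun p => p ∣ D)]
  refine mul_le_mul ?_ ?_ (Finset.prod_nonneg fun p _ => (localLoss_pos _ _ _).le)
    (Finset.prod_nonneg fun p _ => by positivity)
  · calc _ ≤ ∏ p ∈ P.filter (fun p => p ∣ D), (1 + C * (p : ℝ) ^ (-(1 / 2) : ℝ)) := by
          refine Finset.prod_le_prod (fun p _ => (localLoss_pos _ _ _).le) fun p hp => ?_
          obtain ⟨hp1, hp2⟩ := Finset.mem_filter.1 hp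
          have h1 : (1 : ℝ) ≤ p := by exact_mod_cast (prime_of_mem_sievePrimes hp1).one_le
          rw [localLoss, if_pos hp2, ← Real.rpow_neg_one]
          gcongr
          · norm_num
      _ ≤ _ := by
          refine Finset.prod_le_prod_of_subset_of_one_le (fun p hp => ?_)
            (fun p _ => by positivity) fun p _ _ => le_add_of_nonneg_right (by positivity)
          obtain ⟨hp1, hp2⟩ := Finset.mem_filter.1 hp
          exact Nat.mem_primeFactors.2 ⟨prime_of_mem_sievePrimes hp1, hp2, hD⟩
  · calc _ ≤ ∏ p ∈ P.filter (fun p => ¬ p ∣ D), Real.exp (C * ((p : ℝ)⁻¹) ^ 2) := by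
          refine Finset.prod_le_prod (fun p _ => (localLoss_pos _ _ _).le) fun p hp => ?_
          rw [localLoss, if_neg (Finset.mem_filter.1 hp).2, add_comm]
          exact Real.add_one_le_exp _
      _ = Real.exp (C * ∑ p ∈ P.filter (fun p => ¬ p ∣ D), ((p : ℝ)⁻¹) ^ 2) := by
          rw [← Real.exp_sum, Finset.mul_sum]
      _ ≤ _ := by
          gcongr
          exact (Finset.sum_le_sum_of_subset_of_nonneg (Finset.filter_subset _ _)
            fun _ _ _ => by positivity).trans (sum_sievePrimes_inv_sq_le hv N)

theorem diffProd_ne_zero {m : ℕ} {h : Fin m → ℤ} (hh : Function.Injective h) : diffProd h ≠ 0 := by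
  refine Finset.prod_ne_zero_iff.2 fun q hq => ?_
  rw [Int.natAbs_ne_zero, sub_ne_zero]
  exact fun h' => (Finset.mem_filter.1 hq).2.ne (hh h')

theorem dvd_diffProd {m p : ℕ} {h : Fin m → ℤ} {i j : Fin m} (hij : i ≠ j)
    (hp : (h i : ZMod p) = h j) : p ∣ diffProd h := by
  wlog hlt : i < j generalizing i j
  · exact this hij.symm hp.symm (lt_of_le_of_ne (not_lt.1 hlt) hij.symm)
  refine Dvd.dvd.trans ?_ (Finset.dvd_prod_of_mem _
    (Finset.mem_filter.2 ⟨Finset.mem_univ (i, j), hlt⟩))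
  rw [← Int.natCast_dvd, ← ZMod.intCast_eq_intCast_iff_dvd_sub]
  exact hp.symm

theorem tendsto_sieveLevel {k : ℕ} (hk : 1 ≤ k) : Tendsto (sieveLevel k) atTop atTop :=
  (tendsto_rpow_atTop (by positivity)).comp tendsto_natCast_atTop_atTop

/-- Allows the additive interval error to be absorbed into the main term. -/
theorem one_le_mul_log_div_totient {W : ℕ} (hW : W ≠ 0) {R : ℝ} (hR : 3 ≤ R) :
    1 ≤ W * Real.log R / W.totient := by
  have h1 : (0 : ℝ) < W.totient := by exact_mod_cast Nat.totient_pos.2 (Nat.pos_of_ne_zero hW)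
  have h2 : (W.totient : ℝ) ≤ W := by exact_mod_cast Nat.totient_le W
  have h3 : 1 ≤ Real.log R := by
    rw [Real.le_log_iff_exp_le (by linarith)]
    exact Real.exp_one_lt_d9.le.trans (by linarith)
  rw [one_le_div h1]
  nlinarith

/-- The correlation estimate with explicit error terms, given a bound for the pair sums. -/
theorem intAverage_prod_truncLambda_sq_le {m v : ℕ} (hm : 1 ≤ m) (hv : v ≠ 0) {R η : ℝ}
    (hR : 3 ≤ R) (hη : 0 ≤ η)
    (hpair : ∀ a b, |pairSum (primorial v) R a b| ≤
      (1 + η) * ((primorial v : ℝ) / (primorial v).totient * Real.log R))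
    {h : Fin m → ℤ} (hh : Function.Injective h) {B : Set ℝ} (hB : B.OrdConnected)
    (hb : Bornology.IsBounded B) (hd : R ^ (10 * m) ≤ Metric.diam B) :
    intAverage B (fun x : ℤ => ∏ i, truncLambda R ((primorial v : ℤ) * (x + h i) + 1) ^ 2) ≤
      ((1 + η) ^ m * Real.exp (4 ^ m * localConst m * (v : ℝ)⁻¹) + 2 / R) *
        ((primorial v : ℝ) * Real.log R / (primorial v).totient) ^ m *
        ∏ p ∈ (diffProd h).primeFactors,
          (1 + 4 ^ m * localConst m * (p : ℝ) ^ (-(1 / 2) : ℝ)) := by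
  classical
  set W := primorial v with hW
  have hW0 : W ≠ 0 := (primorial_pos v).ne'
  have hR1 : 1 ≤ R := by linarith
  have hR0 : 0 < R := by linarith
  set X := (W : ℝ) * Real.log R / W.totient with hX_def
  have hX : 1 ≤ X := one_le_mul_log_div_totient hW0 hR
  set E := Real.exp (4 ^ m * localConst m * (v : ℝ)⁻¹)
  set F := ∏ p ∈ (diffProd h).primeFactors,
    (1 + 4 ^ m * localConst m * (p : ℝ) ^ (-(1 / 2) : ℝ))
  have hF : 1 ≤ F := by
    have := localConst_pos m
    exact Finset.one_le_prod fun p _ => le_add_of_nonneg_right (by positivity)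
  have hRpow : R ≤ R ^ (10 * m) := le_self_pow₀ hR1 (by omega)
  obtain ⟨a, L, hL, havg⟩ := exists_intAverage_eq hB hb (by linarith)
  have hL0 : (0 : ℝ) < L := by linarith
  have hpair' : ∀ a b, |pairSum W R a b| ≤ (1 + η) * X := fun a b =>
    (hpair a b).trans_eq (by rw [hX_def]; ring)
  have hsum := sum_range_prod_truncLambda_le hR1 hpair' h (bad := fun p => p ∣ diffProd h)
    fun p hp i j hij h' => hp (dvd_diffProd hij h')
  have herr := abs_sum_prod_truncLambda_sub_le W hR1 (fun j : Fin m × Bool => h j.1) a L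
  simp only [Fintype.card_prod, Fintype.card_fin, Fintype.card_bool] at hsum herr
  set Q := ∏ p ∈ sievePrimes W ⌊R⌋₊, p
  have hQ : (0 : ℝ) < Q := by
    exact_mod_cast Nat.pos_of_ne_zero (prod_sievePrimes_ne_zero W ⌊R⌋₊)
  rw [← div_le_iff₀' hQ] at hsum
  have hloss := prod_localLoss_le hv m ⌊R⌋₊ (diffProd_ne_zero hh)
  have hmain := (le_abs_self _).trans herr
  have hXm : 0 < ((1 + η) * X) ^ m := by positivity
  -- With 2m coordinates the interval error is R^{6m}, while L ≥ R^{10m} - 1; the 2 pays for the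
  -- lost 1, and 6m + 1 ≤ 10m uses m ≥ 1.
  have hquot : R ^ (3 * (m * 2)) / L ≤ 2 / R := by
    rw [div_le_div_iff₀ hL0 hR0, ← pow_succ]
    have : R ^ (3 * (m * 2) + 1) ≤ R ^ (10 * m) := pow_le_pow_right₀ hR1 (by omega)
    linarith
  rw [havg]
  have hsq : ∀ x : ℤ, ∏ i, truncLambda R ((W : ℤ) * (x + h i) + 1) ^ 2 =
      ∏ j : Fin m × Bool, truncLambda R (W * (x + h j.1) + 1) := fun x => by
    rw [Fintype.prod_prod_type]
    simp [sq]
  simp only [hsq]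
  calc _ ≤ (L * ((F * E) * ((1 + η) * X) ^ m) + R ^ (3 * (m * 2))) / L := by
        gcongr
        have : L * (_ / (Q : ℝ)) ≤ L * ((F * E) * ((1 + η) * X) ^ m) :=
          mul_le_mul_of_nonneg_left (hsum.trans (mul_le_mul_of_nonneg_right hloss hXm.le)) hL0.le
        linarith
    _ = (1 + η) ^ m * E * X ^ m * F + R ^ (3 * (m * 2)) / L := by
        rw [mul_pow, add_div, mul_div_cancel_left₀ _ hL0.ne']
        ring
    _ ≤ (1 + η) ^ m * E * X ^ m * F + 2 / R * (X ^ m * F) := by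
        gcongr
        refine hquot.trans (le_mul_of_one_le_right (by positivity) ?_)
        exact one_le_mul_of_one_le_of_one_le (one_le_pow₀ hX) hF
    _ = _ := by ring

end GoldstonYildirim

end

theorem proposition9p6 :
    ∃ C : ℕ → ℝ, (∀ m, 0 < C m) ∧
      ∀ k : ℕ, 1 ≤ k →
        -- `w` is sufficiently slowly growing: it tends to infinity and is eventually at most `w₀`
        ∃ w₀ : ℕ → ℝ, Tendsto w₀ atTop atTop ∧
          ∀ w : ℕ → ℝ, Tendsto w atTop atTop → (∀ᶠ N in atTop, w N ≤ w₀ N) →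
            ∀ m : ℕ, 1 ≤ m →
              ∃ ε : ℕ → ℝ, Tendsto ε atTop (𝓝 0) ∧
                ∀ᶠ N : ℕ in atTop,
                  ∀ h : Fin m → ℤ, Function.Injective h → (∀ i, |h i| ≤ (N : ℤ) ^ 2) →
                    -- `B` is a bounded interval, whose length is its diameter
                    ∀ B : Set ℝ, B.OrdConnected → Bornology.IsBounded B →
                      GoldstonYildirim.sieveLevel k N ^ (10 * m) ≤ Metric.diam B →
                        GoldstonYildirim.intAverage B (fun x : ℤ =>
                            ∏ i : Fin m, GoldstonYildirim.truncLambda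
                              (GoldstonYildirim.sieveLevel k N)
                              ((GoldstonYildirim.primeProd (w N) : ℤ) * (x + h i) + 1) ^ 2)
                          ≤ (1 + ε N) *
                            ((GoldstonYildirim.primeProd (w N) : ℝ) *
                                Real.log (GoldstonYildirim.sieveLevel k N) /
                              ((GoldstonYildirim.primeProd (w N)).totient : ℝ)) ^ m *
                            ∏ p ∈ (GoldstonYildirim.diffProd h).primeFactors,
                              (1 + C m * (p : ℝ) ^ (-(1 / 2) : ℝ)) := by
  refine ⟨fun m => 4 ^ m * GoldstonYildirim.localConst m, fun m => ?_, fun k hk => ?_⟩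
  · have := GoldstonYildirim.localConst_pos m
    positivity
  have hRtop := GoldstonYildirim.tendsto_sieveLevel hk
  -- The modulus is fixed here, with η = 1/(v + 1), which tends to 0 when v = ⌊w N⌋ grows.
  have hpair : ∀ v : ℕ, ∀ᶠ N : ℕ in atTop, ∀ a b : ℕ,
      |GoldstonYildirim.pairSum (primorial v) (GoldstonYildirim.sieveLevel k N) a b| ≤
        (1 + 1 / ((v : ℝ) + 1)) * ((primorial v : ℝ) / (primorial v).totient *
          Real.log (GoldstonYildirim.sieveLevel k N)) := fun v => by
    have : NeZero (primorial v) := ⟨(primorial_pos v).ne'⟩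
    exact hRtop.eventually (GoldstonYildirim.eventually_abs_pairSum_le (primorial v)
      (Nat.one_div_pos_of_nat (α := ℝ)))
  obtain ⟨g, hg, hgP⟩ := GoldstonYildirim.exists_tendsto_atTop_forall_le hpair
  refine ⟨fun N => g N, tendsto_natCast_atTop_atTop.comp hg, fun w hw hwg m hm => ?_⟩
  have hv : Tendsto (fun N => ⌊w N⌋₊) atTop atTop := tendsto_nat_floor_atTop.comp hw
  -- The three sources of error: the pair sums, the primes above w not dividing Δ, and the passage
  -- from a full period to B.
  refine ⟨fun N => ((1 + 1 / ((⌊w N⌋₊ : ℝ) + 1)) ^ m *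
    Real.exp (4 ^ m * GoldstonYildirim.localConst m * (⌊w N⌋₊ : ℝ)⁻¹) +
      2 / GoldstonYildirim.sieveLevel k N) - 1, ?_, ?_⟩
  · have h1 := (tendsto_one_div_add_atTop_nhds_zero_nat (𝕜 := ℝ)).comp hv
    have h2 := (tendsto_inv_atTop_nhds_zero_nat (𝕜 := ℝ)).comp hv
    have h3 := hRtop.const_div_atTop 2
    have h4 := ((((h1.const_add 1).pow m).mul ((Real.continuous_exp.tendsto _).comp
      (h2.const_mul (4 ^ m * GoldstonYildirim.localConst m)))).add h3).sub_const 1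
    simpa using h4
  · filter_upwards [hgP, hwg, hv.eventually_ge_atTop 1, hRtop.eventually_ge_atTop 3]
      with N h1 h2 h3 h4 h hh _ B hB hb hd
    rw [add_sub_cancel]
    exact GoldstonYildirim.intAverage_prod_truncLambda_sq_le hm (by omega) h4 (by positivity)
      (h1 _ (Nat.floor_le_of_le h2)) hh hB hb hd
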